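/- Let $n\in\mathbb N$, $I=\{1,\dots,n\}$, let $a_J\ge 0$ ($J\subset I$) satisfy $a_\emptyset=0$, $\sum_J a_J=1$, and let $\gamma_i>0$ ($i\in I$) satisfy $\sum_i\gamma_i=1$. For $A\subset I$ put $\mathcal P_A=\{J\subset A: a_J>0\}$, $\mathcal P=\mathcal P_I$, $\alpha(A)=\sum_{J\in\mathcal P_A}a_J$, $\gamma(A)=\sum_{i\in A}\gamma_i$. For $N\in\mathbb N$ and $i\in I$ let $\Sigma_N^i$ be a finite set with $M_i(N)\ge 1$ elements, where $\frac1N\log_2 M_i(N)\to\gamma_i$ as $N\to\infty$ (for instance $M_i(N)=2^{\gamma_iN}$, rounded to an integer where necessary), and let $\Sigma_N=\prod_{i\in I}\Sigma_N^i$. For $\sigma\in\Sigma_N$ and $J\subset I$ write $\sigma_J=(\sigma_j)_{j\in J}$. For every $N$ let $X^J_{\tau}$ ($J\in\mathcal P$, $\tau\in\prod_{j\in J}\Sigma_N^j$) be independent centered Gaussian variables with variance $a_JN$; for different $N$ they are defined on one probability space, with an arbitrary joint law. Let $$X_\sigma=\sum_{J\in\mathcal P}X^J_{\sigma_J},\qquad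 F_N(\beta)=\frac1N\log\Bigl(\frac1{|\Sigma_N|}\sum_{\sigma\in\Sigma_N}e^{\beta X_\sigma}\Bigr),\qquad f_N(\beta)=\mathbb E F_N(\beta).$$ A chain is a sequence $S=(A_0,\dots,A_K)$ of subsets of $I$ with $\emptyset=A_0\subsetneq A_1\subsetneq\dots\subsetneq A_K=I$. The GREM attached to $S$ is the model defined as above with the same $\Sigma_N^i$, but with the weights $\hat a_{A_j}=\sum_{B\in\mathcal P_{A_j}\setminus\mathcal P_{A_{j-1}}}a_B$ for $1\le j\le K$ and weight $0$ for all other subsets of $I$, in place of $(a_J)$; $f_N(S,\beta)$ is its expected free energy. For $B\subsetneq A\subset I$ let $\rho(B,A)=\sqrt{\frac{2\log 2\,(\gamma(A)-\gamma(B))}{\alpha(A)-\alpha(B)}}\in(0,\infty]$ (equal to $\infty$ if $\alpha(A)=\alpha(B)$), and for $B\ne I$ let $\hat\rho(B)=\min_{A\supsetneq B}\rho(B,A)$. **Theorem.** All expectations above exist, and: 1. For every $\beta\in\mathbb R$ the limit $f(\beta)=\lim_{N\to\infty}f_N(\beta)$ exists, and $F_N(\beta)\to f(\beta)$ almost surely.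 For every chain $S$ the limit $f(S,\beta)=\lim_{N\to\infty}f_N(S,\beta)$ exists. 2. There is exactly one chain $T=(A_0,\dots,A_K)$ such that, for $0\le k<K$, $\rho(A_k,A_{k+1})=\hat\rho(A_k)$ and $A_{k+1}$ contains every $A\supsetneq A_k$ with $\rho(A_k,A)=\hat\rho(A_k)$. With $\beta_0=0$ and $\beta_{k+1}=\hat\rho(A_k)$ for $0\le k<K$ one has $0=\beta_0<\beta_1<\dots<\beta_K\le\infty$, and $\beta_K<\infty$ if $\bigcup_{J\in\mathcal P}J=I$. 3. For this chain $T$, $f(\beta)=f(T,\beta)$ for all $\beta\ge 0$. 4. $f(\beta)=\min_S f(S,\beta)$ for every $\beta\in\mathbb R$, the minimum being over all chains $S$. 5. With $\beta_{K+1}=\infty$: for $0\le k\le K$ and all real $\beta\geq 0$ with $\beta_k\le\beta\le\beta_{k+1}$, $$f(\beta)=\beta\sum_{i=1}^k\beta_i\,[\alpha(A_i)-\alpha(A_{i-1})]-\gamma(A_k)\log 2+\frac{\beta^2}{2}\,(1-\alpha(A_k)).$$ -/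

import Mathlib

open MeasureTheory ProbabilityTheory Filter Topology
open scoped ENNReal NNReal

noncomputable section

namespace NHGrem

variable {n : ℕ}

open Classical in
/-- `𝒫_A`: the subsets `J ⊆ A` with `a_J > 0`. -/
def posSets (a : Finset (Fin n) → ℝ) (A : Finset (Fin n)) : Finset (Finset (Fin n)) :=
  A.powerset.filter fun J => 0 < a J

/-- `α(A) = ∑_{J ∈ 𝒫_A} a_J`. -/
def alpha (a : Finset (Fin n) → ℝ) (A : Finset (Fin n)) : ℝ :=
  ∑ J ∈ posSets a A, a J

/-- `γ(A) = ∑_{i ∈ A} γ_i`. -/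
def gam (γ : Fin n → ℝ) (A : Finset (Fin n)) : ℝ :=
  ∑ i ∈ A, γ i

/-! ### The model -/

/-- Spin configurations `σ = (σ_1, …, σ_n)`, where `σ_i` takes `m i` values. -/
abbrev Config (m : Fin n → ℕ) : Type :=
  ∀ i, Fin (m i)

/-- The index set of the Gaussian variables `X^J_τ`: all pairs `(J, τ)` where `J ∈ 𝒫` and
`τ = (τ_j)_{j ∈ J}`. -/
abbrev Site (a : Finset (Fin n) → ℝ) (m : Fin n → ℕ) : Type :=
  Σ J : {J // J ∈ posSets a Finset.univ}, ∀ i : {i // i ∈ J.1}, Fin (m i)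

/-- The Hamiltonian `X_σ = ∑_{J ∈ 𝒫} X^J_{σ_J}`. -/
def hamiltonian (a : Finset (Fin n) → ℝ) (m : Fin n → ℕ) (x : Site a m → ℝ)
    (σ : Config m) : ℝ :=
  ∑ J : {J // J ∈ posSets a Finset.univ}, x ⟨J, fun i => σ i⟩

/-- `Z_N(β, x) = tr exp(β x)`, with `tr` the average over all configurations. -/
def partitionFunction {m : Fin n → ℕ} (β : ℝ) (x : Config m → ℝ) : ℝ :=
  (∑ σ, Real.exp (β * x σ)) / (Fintype.card (Config m) : ℝ)

/-- `F_N(β, x) = (1 / N) log Z_N(β, x)`. -/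
def freeEnergy {m : Fin n → ℕ} (N : ℕ) (β : ℝ) (x : Config m → ℝ) : ℝ :=
  1 / (N : ℝ) * Real.log (partitionFunction β x)

/-- The centered Gaussian law with variance `a_J N` of the variable at the site `(J, τ)`. -/
def siteLaw (a : Finset (Fin n) → ℝ) (m : Fin n → ℕ) (N : ℕ) (s : Site a m) : Measure ℝ :=
  gaussianReal 0 (Real.toNNReal (a s.1.1 * N))

/-- `X` is, under `P`, a family of independent centered Gaussian variables `X^J_τ` with
variances `a_J N`. -/
structure IsGaussianField {Ω : Type*} [MeasurableSpace Ω] (P : Measure Ω)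
    (a : Finset (Fin n) → ℝ) (m : Fin n → ℕ) (N : ℕ) (X : Site a m → Ω → ℝ) : Prop where
  hasLaw : ∀ s, HasLaw (X s) (siteLaw a m N s) P
  indep : iIndepFun X P

/-- The joint law of the family `(X^J_τ)`. -/
def fieldLaw (a : Finset (Fin n) → ℝ) (m : Fin n → ℕ) (N : ℕ) : Measure (Site a m → ℝ) :=
  Measure.pi (siteLaw a m N)

/-! ### Chains and the associated GREMs -/

/-- A chain `∅ = A_0 ⊂ A_1 ⊂ ⋯ ⊂ A_K = I`, with strict inclusions. -/
structure Chain (n : ℕ) where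
  K : ℕ
  A : Fin (K + 1) → Finset (Fin n)
  strictMono : StrictMono A
  first : A 0 = ∅
  last : A (Fin.last K) = Finset.univ

/-- The weight `â_{A_{j+1}} = ∑_{B ∈ 𝒫_{A_{j+1}} ∖ 𝒫_{A_j}} a_B`, `0 ≤ j < K`. -/
def Chain.hatWeight (T : Chain n) (a : Finset (Fin n) → ℝ) (j : Fin T.K) : ℝ :=
  ∑ B ∈ posSets a (T.A j.succ) \ posSets a (T.A j.castSucc), a B

/-- The weights of the coarse-grained model: `â_{A_j}` on `A_j`, `1 ≤ j ≤ K`, and `0` on the sets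
that are not in the chain. -/
def Chain.weight (T : Chain n) (a : Finset (Fin n) → ℝ) (J : Finset (Fin n)) : ℝ :=
  ∑ j : Fin T.K, if J = T.A j.succ then T.hatWeight a j else 0

/-- `f_N(T, β) = E F_N(β, X(T))`, where `X(T)` is the Hamiltonian of the model with the weights
`â_{A_j}`, that is, of the GREM attached to the chain. -/
def Chain.freeEnergyN (T : Chain n) (a : Finset (Fin n) → ℝ) (m : Fin n → ℕ) (N : ℕ)
    (β : ℝ) : ℝ :=
  ∫ x, freeEnergy N β (hamiltonian (T.weight a) m x) ∂(fieldLaw (T.weight a) m N)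

/-! ### The recursive construction -/

open Classical in
/-- `ρ(B, A) = √(2 log 2 (γ(A) - γ(B)) / (α(A) - α(B)))` for `B ⊊ A`, with the value `∞` when
`α(A) = α(B)`. -/
def rho (a : Finset (Fin n) → ℝ) (γ : Fin n → ℝ) (B A : Finset (Fin n)) : ℝ≥0∞ :=
  if alpha a A = alpha a B then ⊤
  else ENNReal.ofReal
    (Real.sqrt (2 * Real.log 2 * (gam γ A - gam γ B) / (alpha a A - alpha a B)))

/-- `ρ̂(B) = min_{A ⊋ B} ρ(B, A)`. -/
def rhoHat (a : Finset (Fin n) → ℝ) (γ : Fin n → ℝ) (B : Finset (Fin n)) : ℝ≥0∞ :=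
  ⨅ (A : Finset (Fin n)) (_ : B ⊂ A), rho a γ B A

/-- The chain arises by the recursion: `A_{j+1}` is the largest set `A ⊋ A_j` that minimizes
`ρ(A_j, A)`. -/
def Chain.IsRecursive (T : Chain n) (a : Finset (Fin n) → ℝ) (γ : Fin n → ℝ) : Prop :=
  ∀ j : Fin T.K,
    rho a γ (T.A j.castSucc) (T.A j.succ) = rhoHat a γ (T.A j.castSucc) ∧
    ∀ A : Finset (Fin n), T.A j.castSucc ⊂ A →
      rho a γ (T.A j.castSucc) A = rhoHat a γ (T.A j.castSucc) → A ⊆ T.A j.succ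

/-- The parameters `β_0 = 0` and `β_{j+1} = ρ̂(A_j)`, `0 ≤ j < K`. -/
def Chain.crit (T : Chain n) (a : Finset (Fin n) → ℝ) (γ : Fin n → ℝ) : Fin (T.K + 1) → ℝ≥0∞ :=
  Fin.cases 0 fun j => rhoHat a γ (T.A j.castSucc)

end NHGrem

end

noncomputable section

namespace NHGrem

variable {n : ℕ}

/-! ### The law of the Gaussian field -/

/-! For `β ≥ 0` the limit is the optimum of an energy-entropy problem. If the level `J` contributes
energy `a_J b_J N`, the Gaussian cost is `exp(-N a_J b_J² / 2)`. Configurations with such energies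
exist only if, for every `A`, the total cost of the levels inside `A` (`budget`) is at most the
entropy `γ(A) log 2`. Under these constraints (`IsFeasible`) one maximises `∑ a_J (β b_J - b_J² /
2)` (`value`).

The lower bound is a second moment argument for the number of configurations whose level variables
all exceed `a_J b_J N`. A pair agreeing exactly on `A` is correlated only through the levels inside
`A`, so strict constraints make the variance exponentially small (`integral_exceedance_sq_le`,
`freeEnergy_lower_tail`). The upper bound uses Lagrange multipliers (`IsDual`). They write `β X_σ`
as an energy with coefficients `b_J` plus a nonnegative combination of its restrictions to sets `A`.
The restrictions are bounded uniformly in `σ`, the remaining energy is averaged, and first moments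
suffice (`averagedWeight_const_le`, `freeEnergy_upper_tail`). Complementary slackness makes the two
bounds agree.

The optimiser takes the slope `min(β, β_{j+1})` on the layer between `A_j` and `A_{j+1}` of the
recursive chain. Supermodularity of `α` and modularity of `γ` give the chain (closure of minimisers
under unions) and feasibility (`Chain.isFeasible_profile`). The multipliers sit on the chain and
come from increments of `β / slope` (`Chain.IsRecursive.exists_isDual`).

Averaging `b` over the layers of a chain `S` preserves energy and does not raise cost, and gives a
feasible point of the GREM of `S`; hence `f ≤ f(S)`. For `S = T` the same certificate works in both
models, since it sees only the numbers `α(A_k)`. Negative `β` follows from the symmetry of the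
Gaussian field. Exponential tails give almost sure convergence by Borel–Cantelli, and with a bound
on `E exp |F_N|` uniform in `N` they give convergence of means. -/

instance isProbabilityMeasure_siteLaw (a : Finset (Fin n) → ℝ) (m : Fin n → ℕ) (N : ℕ)
    (s : Site a m) : IsProbabilityMeasure (siteLaw a m N s) := by
  unfold siteLaw; infer_instance

instance isProbabilityMeasure_fieldLaw (a : Finset (Fin n) → ℝ) (m : Fin n → ℕ) (N : ℕ) :
    IsProbabilityMeasure (fieldLaw a m N) := by
  unfold fieldLaw; infer_instance

/-- The common law of the variables `X^J_τ`. -/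
def levelLaw (a : Finset (Fin n) → ℝ) (N : ℕ) (J : Finset (Fin n)) : Measure ℝ :=
  gaussianReal 0 (Real.toNNReal (a J * N))

instance isProbabilityMeasure_levelLaw (a : Finset (Fin n) → ℝ) (N : ℕ) (J : Finset (Fin n)) :
    IsProbabilityMeasure (levelLaw a N J) := by
  unfold levelLaw; infer_instance

lemma IsGaussianField.hasLaw_field {Ω : Type*} [MeasurableSpace Ω] {P : Measure Ω}
    [IsProbabilityMeasure P] {a : Finset (Fin n) → ℝ} {m : Fin n → ℕ} {N : ℕ}
    {X : Site a m → Ω → ℝ} (hX : IsGaussianField P a m N X) :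
    HasLaw (fun ω s => X s ω) (fieldLaw a m N) P where
  aemeasurable := aemeasurable_pi_lambda _ fun s => (hX.hasLaw s).aemeasurable
  map_eq := by
    rw [(iIndepFun_iff_map_fun_eq_pi_map fun s => (hX.hasLaw s).aemeasurable).1 hX.indep]
    simp only [fun s => (hX.hasLaw s).map_eq, fieldLaw]

instance isNegInvariant_siteLaw (a : Finset (Fin n) → ℝ) (m : Fin n → ℕ) (N : ℕ)
    (s : Site a m) : (siteLaw a m N s).IsNegInvariant := by
  constructor
  have := gaussianReal_map_neg (μ := 0) (v := Real.toNNReal (a s.1.1 * N))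
  rw [neg_zero] at this
  exact this

instance isNegInvariant_fieldLaw (a : Finset (Fin n) → ℝ) (m : Fin n → ℕ) (N : ℕ) :
    (fieldLaw a m N).IsNegInvariant := by
  unfold fieldLaw; infer_instance

/-- The site of level `J` seen by the configuration `σ`. -/
abbrev siteOf {a : Finset (Fin n) → ℝ} {m : Fin n → ℕ} (σ : Config m)
    (J : {J // J ∈ posSets a Finset.univ}) : Site a m :=
  ⟨J, fun i => σ i⟩

/-- Sites not seen by `σ` get the factor 1, so that the integrand becomes a product over all
coordinates of the product measure. -/
lemma prod_siteOf {a : Finset (Fin n) → ℝ} {m : Fin n → ℕ} (g : Finset (Fin n) → ℝ → ℝ)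
    (σ : Config m) (x : Site a m → ℝ) :
    ∏ J, g J.1 (x (siteOf σ J)) =
      ∏ s : Site a m, if s.2 = (fun i : {i // i ∈ s.1.1} => σ i) then g s.1.1 (x s) else 1 := by
  rw [Fintype.prod_sigma]
  refine Finset.prod_congr rfl fun J _ => ?_
  simp

open Classical in
-- At level `J` the two configurations read the same variable if they agree on `J`, and independent
-- ones otherwise. First moments are the case `h = 1`, `σ' = σ`.
lemma integral_prod_siteOf_mul {a : Finset (Fin n) → ℝ} {m : Fin n → ℕ} (N : ℕ)
    (g h : Finset (Fin n) → ℝ → ℝ) (σ σ' : Config m) :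
    ∫ x, (∏ J, g J.1 (x (siteOf σ J))) * ∏ J, h J.1 (x (siteOf σ' J)) ∂(fieldLaw a m N) =
      ∏ J : {J // J ∈ posSets a Finset.univ},
        if ∀ i ∈ J.1, σ i = σ' i then ∫ y, g J.1 y * h J.1 y ∂(levelLaw a N J.1)
        else (∫ y, g J.1 y ∂(levelLaw a N J.1)) * ∫ y, h J.1 y ∂(levelLaw a N J.1) := by
  simp only [prod_siteOf, ← Finset.prod_mul_distrib]
  rw [fieldLaw, integral_fintype_prod_eq_prod (μ := siteLaw a m N) (fun (s : Site a m) y =>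
    (if s.2 = (fun i : {i // i ∈ s.1.1} => σ i) then g s.1.1 y else 1) *
    (if s.2 = (fun i : {i // i ∈ s.1.1} => σ' i) then h s.1.1 y else 1)), Fintype.prod_sigma]
  refine Finset.prod_congr rfl fun J _ => ?_
  split_ifs with hJ
  · have h1 : (fun i : {i // i ∈ J.1} => σ' i) = fun i : {i // i ∈ J.1} => σ i :=
      funext fun i => (hJ i i.2).symm
    rw [Fintype.prod_eq_single (fun i : {i // i ∈ J.1} => σ i)]
    · simp only [h1, if_true]; rfl
    · intro τ hτ
      simp only [h1, if_neg hτ]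
      simp
  · have h1 : (fun i : {i // i ∈ J.1} => σ i) ≠ fun i : {i // i ∈ J.1} => σ' i :=
      fun h2 => hJ fun i hi => congrFun h2 ⟨i, hi⟩
    rw [Fintype.prod_eq_mul _ _ h1]
    · simp only [if_true, if_neg h1, if_neg h1.symm, mul_one, one_mul]; rfl
    · rintro τ ⟨h2, h3⟩
      simp only [if_neg h2, if_neg h3]
      simp

lemma integrable_prod_siteOf_mul {a : Finset (Fin n) → ℝ} {m : Fin n → ℕ} (N : ℕ)
    {g h : Finset (Fin n) → ℝ → ℝ} (σ σ' : Config m)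
    (hg : ∀ J, Integrable (g J) (levelLaw a N J)) (hh : ∀ J, Integrable (h J) (levelLaw a N J))
    (hgh : ∀ J, Integrable (fun y => g J y * h J y) (levelLaw a N J)) :
    Integrable (fun x => (∏ J, g J.1 (x (siteOf σ J))) * ∏ J, h J.1 (x (siteOf σ' J)))
      (fieldLaw a m N) := by
  simp only [prod_siteOf, ← Finset.prod_mul_distrib]
  refine Integrable.fintype_prod_dep (μ := siteLaw a m N) (f := fun (s : Site a m) y =>
    (if s.2 = (fun i : {i // i ∈ s.1.1} => σ i) then g s.1.1 y else 1) *
    (if s.2 = (fun i : {i // i ∈ s.1.1} => σ' i) then h s.1.1 y else 1)) fun s => ?_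
  split_ifs
  · exact hgh _
  · simp only [mul_one]; exact hg _
  · simp only [one_mul]; exact hh _
  · simp

/-! ### Exponential moments of the energies -/

/-- `∑_J c_J X^J_{σ_J}`. -/
def weightedEnergy (a : Finset (Fin n) → ℝ) (m : Fin n → ℕ) (c : Finset (Fin n) → ℝ)
    (x : Site a m → ℝ) (σ : Config m) : ℝ :=
  ∑ J : {J // J ∈ posSets a Finset.univ}, c J.1 * x (siteOf σ J)

lemma integral_exp_mul_levelLaw {a : Finset (Fin n) → ℝ} (ha : ∀ J, 0 ≤ a J) (N : ℕ)
    (J : Finset (Fin n)) (c : ℝ) :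
    ∫ y, Real.exp (c * y) ∂(levelLaw a N J) = Real.exp (N * (a J * c ^ 2 / 2)) := by
  have h := congrFun (mgf_id_gaussianReal (μ := 0) (v := Real.toNNReal (a J * N))) c
  simp only [mgf, id] at h
  rw [levelLaw, h, Real.coe_toNNReal _ (mul_nonneg (ha J) N.cast_nonneg)]
  congr 1; ring

lemma integrable_exp_weightedEnergy (a : Finset (Fin n) → ℝ) (m : Fin n → ℕ) (N : ℕ)
    (c : Finset (Fin n) → ℝ) (σ : Config m) :
    Integrable (fun x => Real.exp (weightedEnergy a m c x σ)) (fieldLaw a m N) := by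
  have := integrable_prod_siteOf_mul (a := a) (m := m) N (g := fun J y => Real.exp (c J * y))
    (h := fun _ _ => 1) σ σ (fun J => integrable_exp_mul_gaussianReal _) (fun J => by simp)
    (fun J => by simp only [mul_one]; exact integrable_exp_mul_gaussianReal _)
  simpa [weightedEnergy, Real.exp_sum] using this

lemma integral_exp_weightedEnergy {a : Finset (Fin n) → ℝ} (ha : ∀ J, 0 ≤ a J) (m : Fin n → ℕ)
    (N : ℕ) (c : Finset (Fin n) → ℝ) (σ : Config m) :
    ∫ x, Real.exp (weightedEnergy a m c x σ) ∂(fieldLaw a m N) =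
      Real.exp (N * ∑ J ∈ posSets a Finset.univ, a J * c J ^ 2 / 2) := by
  have := integral_prod_siteOf_mul (a := a) (m := m) N (fun J y => Real.exp (c J * y))
    (fun _ _ => 1) σ σ
  simp only [mul_one, Finset.prod_const_one, implies_true, if_true,
    integral_exp_mul_levelLaw ha, ← Real.exp_sum] at this
  rw [← Finset.sum_coe_sort, Finset.mul_sum]
  exact this

/-- The average of `exp (∑_J c_J X^J_{σ_J})` over all configurations `σ`. -/
def averagedWeight (a : Finset (Fin n) → ℝ) (m : Fin n → ℕ) (c : Finset (Fin n) → ℝ)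
    (x : Site a m → ℝ) : ℝ :=
  (∑ σ, Real.exp (weightedEnergy a m c x σ)) / (Fintype.card (Config m) : ℝ)

lemma card_config_pos {m : Fin n → ℕ} (hm : ∀ i, 0 < m i) :
    (0 : ℝ) < (Fintype.card (Config m) : ℝ) := by
  have : Nonempty (Config m) := ⟨fun i => ⟨0, hm i⟩⟩
  exact_mod_cast Fintype.card_pos

lemma averagedWeight_pos {a : Finset (Fin n) → ℝ} {m : Fin n → ℕ} (hm : ∀ i, 0 < m i)
    (c : Finset (Fin n) → ℝ) (x : Site a m → ℝ) : 0 < averagedWeight a m c x := by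
  have : Nonempty (Config m) := ⟨fun i => ⟨0, hm i⟩⟩
  exact div_pos (Finset.sum_pos (fun _ _ => Real.exp_pos _) Finset.univ_nonempty)
    (card_config_pos hm)

lemma integrable_averagedWeight (a : Finset (Fin n) → ℝ) (m : Fin n → ℕ) (N : ℕ)
    (c : Finset (Fin n) → ℝ) : Integrable (averagedWeight a m c) (fieldLaw a m N) :=
  (integrable_finsetSum _ fun σ _ => integrable_exp_weightedEnergy a m N c σ).div_const _

lemma integral_averagedWeight {a : Finset (Fin n) → ℝ} (ha : ∀ J, 0 ≤ a J) {m : Fin n → ℕ}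
    (hm : ∀ i, 0 < m i) (N : ℕ) (c : Finset (Fin n) → ℝ) :
    ∫ x, averagedWeight a m c x ∂(fieldLaw a m N) =
      Real.exp (N * ∑ J ∈ posSets a Finset.univ, a J * c J ^ 2 / 2) := by
  simp only [averagedWeight]
  rw [integral_div, integral_finsetSum _ fun σ _ => integrable_exp_weightedEnergy a m N c σ]
  simp only [integral_exp_weightedEnergy ha]
  rw [Finset.sum_const, Finset.card_univ, nsmul_eq_mul, mul_div_cancel_left₀]
  exact (card_config_pos hm).ne'

lemma partitionFunction_hamiltonian (a : Finset (Fin n) → ℝ) (m : Fin n → ℕ) (β : ℝ)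
    (x : Site a m → ℝ) :
    partitionFunction β (hamiltonian a m x) = averagedWeight a m (fun _ => β) x := by
  simp only [partitionFunction, averagedWeight, weightedEnergy, hamiltonian, Finset.mul_sum]

/-! ### Configurations that agree on a set of coordinates -/

open Classical in
lemma card_agree_mul {m : Fin n → ℕ} (A : Finset (Fin n)) (σ : Config m) :
    (Finset.univ.filter fun σ' : Config m => ∀ i ∈ A, σ i = σ' i).card * ∏ i ∈ A, m i =
      Fintype.card (Config m) := by
  have h1 : (Finset.univ.filter fun σ' : Config m => ∀ i ∈ A, σ i = σ' i) =
      Fintype.piFinset fun i => if i ∈ A then {σ i} else Finset.univ := by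
    ext σ'
    simp only [Finset.mem_filter, Finset.mem_univ, true_and, Fintype.mem_piFinset]
    refine forall_congr' fun i => ?_
    by_cases hi : i ∈ A <;> simp [hi, eq_comm]
  rw [h1, Fintype.card_piFinset, Fintype.card_pi, ← Finset.prod_ite_mem_eq A,
    ← Finset.prod_mul_distrib]
  refine Finset.prod_congr rfl fun i _ => ?_
  by_cases hi : i ∈ A <;> simp [hi]

/-! ### The variational problem and its dual -/

lemma sum_posSets (a : Finset (Fin n) → ℝ) (A : Finset (Fin n)) (g : Finset (Fin n) → ℝ) :
    ∑ J ∈ posSets a A, g J = ∑ J ∈ posSets a Finset.univ, if J ⊆ A then g J else 0 := by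
  rw [← Finset.sum_filter]
  refine Finset.sum_congr ?_ fun _ _ => rfl
  ext J
  simp [posSets, and_comm]

/-- `∑_{J ∈ 𝒫_A} a_J b_J² / 2`, the entropy used by the energy levels `a_J b_J` inside `A`. -/
def budget (a b : Finset (Fin n) → ℝ) (A : Finset (Fin n)) : ℝ :=
  ∑ J ∈ posSets a A, a J * b J ^ 2 / 2

/-- The energy-entropy functional `∑_J a_J (β b_J - b_J² / 2)`. -/
def value (a : Finset (Fin n) → ℝ) (β : ℝ) (b : Finset (Fin n) → ℝ) : ℝ :=
  ∑ J ∈ posSets a Finset.univ, a J * (β * b J - b J ^ 2 / 2)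

/-- The energy levels `a_J b_J` obey all the entropy constraints. -/
structure IsFeasible (a : Finset (Fin n) → ℝ) (γ : Fin n → ℝ) (b : Finset (Fin n) → ℝ) :
    Prop where
  nonneg : ∀ J, 0 ≤ b J
  budget_le : ∀ A, budget a b A ≤ gam γ A * Real.log 2

/-- Lagrange multipliers `lam` for the entropy constraints that certify the optimality of `b`. -/
structure IsDual (a : Finset (Fin n) → ℝ) (γ : Fin n → ℝ) (β : ℝ)
    (b lam : Finset (Fin n) → ℝ) : Prop where
  nonneg : ∀ A, 0 ≤ lam A
  stationary : ∀ J ∈ posSets a Finset.univ, β = b J * (1 + ∑ A, if J ⊆ A then lam A else 0)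
  slack : ∀ A, lam A ≠ 0 → budget a b A = gam γ A * Real.log 2

lemma sum_mul_budget (a b lam : Finset (Fin n) → ℝ) :
    ∑ A, lam A * budget a b A = ∑ J ∈ posSets a Finset.univ,
      a J * b J ^ 2 / 2 * ∑ A, if J ⊆ A then lam A else 0 := by
  simp only [budget, sum_posSets a _ (fun J => a J * b J ^ 2 / 2), Finset.mul_sum]
  rw [Finset.sum_comm]
  refine Finset.sum_congr rfl fun J _ => Finset.sum_congr rfl fun A _ => ?_
  split_ifs <;> ring

/-- The right-hand side is the exponent that the upper bound produces: for each `A` the entropy plus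
the first moment exponent, then one unrestricted average. Slackness turns each bracket into twice
the budget, and stationarity matches the coefficients of each level. -/
lemma IsDual.value_eq {a : Finset (Fin n) → ℝ} {γ : Fin n → ℝ} {β : ℝ}
    {b lam : Finset (Fin n) → ℝ} (h : IsDual a γ β b lam) :
    value a β b = ∑ A, lam A * (gam γ A * Real.log 2 + budget a b A) +
      budget a b Finset.univ := by
  have h1 : ∀ A, lam A * (gam γ A * Real.log 2 + budget a b A) =
      2 * (lam A * budget a b A) := fun A => by
    by_cases hA : lam A = 0
    · simp [hA]
    · rw [h.slack A hA]; ring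
  simp only [h1]
  rw [← Finset.mul_sum, sum_mul_budget, budget, value, Finset.mul_sum, ← Finset.sum_add_distrib]
  refine Finset.sum_congr rfl fun J hJ => ?_
  rw [h.stationary J hJ]
  ring

/-- Weak duality. -/
lemma IsFeasible.value_le {a : Finset (Fin n) → ℝ} (ha : ∀ J, 0 ≤ a J) {γ : Fin n → ℝ} {β : ℝ}
    {b b' lam : Finset (Fin n) → ℝ} (h' : IsFeasible a γ b') (h : IsDual a γ β b lam) :
    value a β b' ≤ value a β b := by
  have h1 : ∑ A, lam A * budget a b' A ≤ ∑ A, lam A * budget a b A := by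
    refine Finset.sum_le_sum fun A _ => ?_
    by_cases hA : lam A = 0
    · simp [hA]
    · rw [h.slack A hA]
      exact mul_le_mul_of_nonneg_left (h'.budget_le A) (h.nonneg A)
  rw [sum_mul_budget, sum_mul_budget] at h1
  -- With the multipliers included the problem separates over `J`, and stationarity says that `b J`
  -- maximises the concave quadratic `β y - (1 + L) y² / 2`.
  have h2 : ∀ J ∈ posSets a Finset.univ,
      a J * (β * b' J - b' J ^ 2 / 2)
        - a J * b' J ^ 2 / 2 * (∑ A, if J ⊆ A then lam A else 0) ≤
      a J * (β * b J - b J ^ 2 / 2)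
        - a J * b J ^ 2 / 2 * (∑ A, if J ⊆ A then lam A else 0) := by
    intro J hJ
    have h3 : 0 ≤ ∑ A, if J ⊆ A then lam A else 0 :=
      Finset.sum_nonneg fun A _ => by split_ifs; exacts [h.nonneg A, le_rfl]
    rw [h.stationary J hJ]
    set L := ∑ A, if J ⊆ A then lam A else 0
    have := mul_nonneg (ha J) (mul_nonneg (by linarith : 0 ≤ 1 + L) (sq_nonneg (b J - b' J)))
    nlinarith
  have h4 := Finset.sum_le_sum h2
  rw [Finset.sum_sub_distrib, Finset.sum_sub_distrib] at h4
  unfold value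
  linarith

/-! ### The upper bound -/

/-- The part of the coefficients that belongs to the subsets of `A`. -/
def restrict (b : Finset (Fin n) → ℝ) (A J : Finset (Fin n)) : ℝ :=
  if J ⊆ A then b J else 0

lemma integral_averagedWeight_restrict {a : Finset (Fin n) → ℝ} (ha : ∀ J, 0 ≤ a J)
    {m : Fin n → ℕ} (hm : ∀ i, 0 < m i) (N : ℕ) (b : Finset (Fin n) → ℝ) (A : Finset (Fin n)) :
    ∫ x, averagedWeight a m (restrict b A) x ∂(fieldLaw a m N) =
      Real.exp (N * budget a b A) := by
  rw [integral_averagedWeight ha hm, budget, sum_posSets a A]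
  congr 2
  refine Finset.sum_congr rfl fun J _ => ?_
  unfold restrict
  split_ifs <;> simp

lemma weightedEnergy_restrict_congr {a : Finset (Fin n) → ℝ} {m : Fin n → ℕ}
    (b : Finset (Fin n) → ℝ) (A : Finset (Fin n)) (x : Site a m → ℝ) {σ σ' : Config m}
    (h : ∀ i ∈ A, σ i = σ' i) :
    weightedEnergy a m (restrict b A) x σ' = weightedEnergy a m (restrict b A) x σ := by
  refine Finset.sum_congr rfl fun J _ => ?_
  unfold restrict
  split_ifs with hJ
  · have : (fun i : {i // i ∈ J.1} => σ' i) = fun i : {i // i ∈ J.1} => σ i :=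
      funext fun i => (h i (hJ i.2)).symm
    simp only [siteOf, this]
  · simp

/-- The restricted energy depends only on `σ_A`, so its value at `σ` occurs in the average with
frequency at least `1 / ∏_{i ∈ A} m_i`. -/
lemma exp_weightedEnergy_restrict_le {a : Finset (Fin n) → ℝ} {m : Fin n → ℕ}
    (hm : ∀ i, 0 < m i) (b : Finset (Fin n) → ℝ) (A : Finset (Fin n)) (x : Site a m → ℝ)
    (σ : Config m) :
    Real.exp (weightedEnergy a m (restrict b A) x σ) ≤
      (∏ i ∈ A, (m i : ℝ)) * averagedWeight a m (restrict b A) x := by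
  classical
  have h1 : ((Finset.univ.filter fun σ' : Config m => ∀ i ∈ A, σ i = σ' i).card : ℝ) *
      Real.exp (weightedEnergy a m (restrict b A) x σ) ≤
      ∑ σ', Real.exp (weightedEnergy a m (restrict b A) x σ') := by
    rw [← nsmul_eq_mul, ← Finset.sum_const]
    refine (Finset.sum_le_sum fun σ' hσ' => ?_).trans
      (Finset.sum_le_sum_of_subset_of_nonneg (Finset.filter_subset _ _)
        fun _ _ _ => (Real.exp_pos _).le)
    rw [weightedEnergy_restrict_congr b A x (Finset.mem_filter.1 hσ').2]
  have h2 : ((Finset.univ.filter fun σ' : Config m => ∀ i ∈ A, σ i = σ' i).card : ℝ) *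
      ∏ i ∈ A, (m i : ℝ) = Fintype.card (Config m) := by
    exact_mod_cast card_agree_mul A σ
  have h3 : (0 : ℝ) < ∏ i ∈ A, (m i : ℝ) :=
    Finset.prod_pos fun i _ => by exact_mod_cast hm i
  rw [averagedWeight, mul_div_assoc', le_div_iff₀ (card_config_pos hm), ← h2]
  nlinarith

/-- A deterministic bound, valid for every `x`: stationarity splits `β X_σ` into the energy with
coefficients `b` and the `lam`-combination of its restrictions, and only the latter is replaced by
its maximum over `σ`. -/
lemma averagedWeight_const_le {a : Finset (Fin n) → ℝ} {γ : Fin n → ℝ} {m : Fin n → ℕ}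
    (hm : ∀ i, 0 < m i) {β : ℝ} {b lam : Finset (Fin n) → ℝ} (h : IsDual a γ β b lam)
    (x : Site a m → ℝ) :
    Real.log (averagedWeight a m (fun _ => β) x) ≤
      ∑ A, lam A * (Real.log (∏ i ∈ A, (m i : ℝ)) +
          Real.log (averagedWeight a m (restrict b A) x)) +
        Real.log (averagedWeight a m (restrict b Finset.univ) x) := by
  have hm' : ∀ A : Finset (Fin n), (0 : ℝ) < ∏ i ∈ A, (m i : ℝ) := fun A =>
    Finset.prod_pos fun i _ => by exact_mod_cast hm i
  set E := ∑ A, lam A * (Real.log (∏ i ∈ A, (m i : ℝ)) +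
          Real.log (averagedWeight a m (restrict b A) x)) with hE
  have h1 : ∀ σ, weightedEnergy a m (fun _ => β) x σ =
      weightedEnergy a m (restrict b Finset.univ) x σ +
        ∑ A, lam A * weightedEnergy a m (restrict b A) x σ := by
    intro σ
    simp only [weightedEnergy, Finset.mul_sum]
    rw [Finset.sum_comm, ← Finset.sum_add_distrib]
    refine Finset.sum_congr rfl fun J _ => ?_
    rw [h.stationary J.1 J.2]
    have : ∀ A, lam A * (restrict b A J.1 * x (siteOf σ J)) =
        (if J.1 ⊆ A then lam A else 0) * (b J.1 * x (siteOf σ J)) := fun A => by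
      unfold restrict; split_ifs <;> simp
    simp only [this, ← Finset.sum_mul]
    simp only [restrict, Finset.subset_univ, if_true]
    ring
  have h2 : ∀ σ, ∑ A, lam A * weightedEnergy a m (restrict b A) x σ ≤ E := by
    intro σ
    refine Finset.sum_le_sum fun A _ => mul_le_mul_of_nonneg_left ?_ (h.nonneg A)
    rw [← Real.log_mul (hm' A).ne' (averagedWeight_pos hm _ _).ne',
      Real.le_log_iff_exp_le (mul_pos (hm' A) (averagedWeight_pos hm _ _))]
    exact exp_weightedEnergy_restrict_le hm b A x σ
  rw [Real.log_le_iff_le_exp (averagedWeight_pos hm _ _), Real.exp_add,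
    Real.exp_log (averagedWeight_pos hm _ _), averagedWeight, averagedWeight, mul_div_assoc',
    Finset.mul_sum]
  refine div_le_div_of_nonneg_right (Finset.sum_le_sum fun σ _ => ?_) (card_config_pos hm).le
  rw [← Real.exp_add, Real.exp_le_exp, h1]
  linarith [h2 σ]

lemma tendsto_log_card {γ : Fin n → ℝ} {M : ℕ → Fin n → ℕ} (hM_pos : ∀ N i, 0 < M N i)
    (hM : ∀ i, Tendsto (fun N : ℕ => Real.logb 2 (M N i) / (N : ℝ)) atTop (𝓝 (γ i)))
    (A : Finset (Fin n)) :
    Tendsto (fun N : ℕ => Real.log (∏ i ∈ A, (M N i : ℝ)) / N) atTop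
      (𝓝 (gam γ A * Real.log 2)) := by
  have h := (tendsto_finsetSum A fun i _ => hM i).mul_const (Real.log 2)
  refine h.congr fun N => ?_
  rw [Real.log_prod fun i _ => by exact_mod_cast (hM_pos N i).ne', ← Finset.sum_div,
    div_mul_eq_mul_div, Finset.sum_mul]
  congr 1
  refine Finset.sum_congr rfl fun i _ => ?_
  rw [Real.logb, div_mul_cancel₀]
  exact (Real.log_pos one_lt_two).ne'

/-- Half of the rate absorbs the constants produced by union bounds. -/
lemma eventually_const_mul_exp_le (C : ℝ) {δ : ℝ} (hδ : 0 < δ) :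
    ∀ᶠ N : ℕ in atTop, C * Real.exp (-(δ * N)) ≤ Real.exp (-(δ / 2 * N)) := by
  have h1 : Tendsto (fun N : ℕ => Real.exp (δ / 2 * N)) atTop atTop :=
    Real.tendsto_exp_atTop.comp
      (Tendsto.const_mul_atTop (by positivity) tendsto_natCast_atTop_atTop)
  filter_upwards [h1.eventually_ge_atTop C] with N hN
  calc C * Real.exp (-(δ * N)) ≤ Real.exp (δ / 2 * N) * Real.exp (-(δ * N)) := by gcongr
    _ = _ := by rw [← Real.exp_add]; congr 1; ring

lemma freeEnergy_upper_tail {a : Finset (Fin n) → ℝ} (ha : ∀ J, 0 ≤ a J) {γ : Fin n → ℝ}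
    {M : ℕ → Fin n → ℕ} (hM_pos : ∀ N i, 0 < M N i)
    (hM : ∀ i, Tendsto (fun N : ℕ => Real.logb 2 (M N i) / (N : ℝ)) atTop (𝓝 (γ i)))
    {β : ℝ} {b lam : Finset (Fin n) → ℝ} (h : IsDual a γ β b lam) {ε : ℝ} (hε : 0 < ε) :
    ∃ c > 0, ∀ᶠ N : ℕ in atTop, (fieldLaw a (M N) N).real
      {x | value a β b + ε < freeEnergy N β (hamiltonian a (M N) x)} ≤ Real.exp (-(c * N)) := by
  set L := ∑ A, lam A with hL
  have hL0 : 0 ≤ L := Finset.sum_nonneg fun A _ => h.nonneg A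
  -- Each multiplier loses `δ` twice, for the cardinality and for the first moment, and the
  -- unrestricted average once: `(2 L + 1) δ = ε`.
  set δ := ε / (2 * L + 1) with hδ
  have hδ0 : 0 < δ := by positivity
  refine ⟨δ / 2, by positivity, ?_⟩
  have h1 : ∀ᶠ N : ℕ in atTop, ∀ A : Finset (Fin n),
      Real.log (∏ i ∈ A, (M N i : ℝ)) / N < gam γ A * Real.log 2 + δ :=
    eventually_all.2 fun A => (tendsto_log_card hM_pos hM A).eventually_lt_const (by linarith)
  filter_upwards [h1, eventually_const_mul_exp_le (Fintype.card (Finset (Fin n)) : ℝ) hδ0,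
    eventually_gt_atTop 0] with N hN1 hN2 hN0
  have hN0' : (0 : ℝ) < N := by exact_mod_cast hN0
  refine le_trans ?_ hN2
  set Q : Finset (Fin n) → (Site a (M N) → ℝ) → ℝ :=
    fun A x => averagedWeight a (M N) (restrict b A) x with hQ
  have hsub : {x | value a β b + ε < freeEnergy N β (hamiltonian a (M N) x)} ⊆
      ⋃ A, {x | Real.exp (N * (budget a b A + δ)) ≤ Q A x} := by
    intro x hx
    by_contra hcon
    simp only [Set.mem_iUnion, Set.mem_ofPred_eq, not_exists, not_le] at hcon hx
    have h3 : ∀ A, Real.log (Q A x) ≤ N * (budget a b A + δ) := fun A =>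
      (Real.log_le_iff_le_exp (averagedWeight_pos (hM_pos N) _ _)).2 (hcon A).le
    have h4 := averagedWeight_const_le (hM_pos N) h x
    have h5 : ∑ A, lam A * (Real.log (∏ i ∈ A, (M N i : ℝ)) + Real.log (Q A x)) ≤
        N * (∑ A, lam A * (gam γ A * Real.log 2 + budget a b A) + 2 * L * δ) := by
      have h6 : ∑ A, lam A * (gam γ A * Real.log 2 + budget a b A) + 2 * L * δ =
          ∑ A, lam A * (gam γ A * Real.log 2 + budget a b A + 2 * δ) := by
        simp only [mul_add, Finset.sum_add_distrib, ← Finset.sum_mul]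
        rw [← hL]; ring
      rw [h6, Finset.mul_sum]
      refine Finset.sum_le_sum fun A _ => ?_
      have := (div_lt_iff₀ hN0').1 (hN1 A)
      rw [mul_left_comm]
      refine mul_le_mul_of_nonneg_left ?_ (h.nonneg A)
      linarith [h3 A]
    have h7 : freeEnergy N β (hamiltonian a (M N) x) ≤ value a β b + ε := by
      rw [freeEnergy, partitionFunction_hamiltonian, one_div, inv_mul_le_iff₀ hN0', h.value_eq]
      have h8 : ε = (2 * L + 1) * δ := by rw [hδ]; field_simp
      rw [h8]
      linarith [h3 Finset.univ]
    linarith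
  -- Markov's inequality; the mean of `Q A` is `exp(N · budget)`.
  have hmark : ∀ A, (fieldLaw a (M N) N).real {x | Real.exp (N * (budget a b A + δ)) ≤ Q A x} ≤
      Real.exp (-(δ * N)) := by
    intro A
    have := mul_meas_ge_le_integral_of_nonneg (μ := fieldLaw a (M N) N) (f := Q A)
      (ae_of_all _ fun x => (averagedWeight_pos (hM_pos N) _ _).le)
      (integrable_averagedWeight a (M N) N _) (Real.exp (N * (budget a b A + δ)))
    rw [hQ, integral_averagedWeight_restrict ha (hM_pos N),
      ← le_div_iff₀' (Real.exp_pos _), ← Real.exp_sub] at this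
    refine this.trans (le_of_eq ?_)
    congr 1; ring
  calc _ ≤ (fieldLaw a (M N) N).real (⋃ A, {x | Real.exp (N * (budget a b A + δ)) ≤ Q A x}) :=
        measureReal_mono hsub
    _ ≤ ∑ A, (fieldLaw a (M N) N).real {x | Real.exp (N * (budget a b A + δ)) ≤ Q A x} :=
        measureReal_iUnion_fintype_le _
    _ ≤ ∑ A : Finset (Fin n), Real.exp (-(δ * N)) := Finset.sum_le_sum fun A _ => hmark A
    _ = _ := by rw [Finset.sum_const, Finset.card_univ, nsmul_eq_mul]

/-! ### The lower bound -/

/-- Integrate the density over one standard deviation, `[t, t + √v]`: the length cancels the factor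
`√v` of the normalisation, and the density is smallest at the right end. -/
lemma gaussianReal_Ici_ge {v : ℝ≥0} (hv : v ≠ 0) {t : ℝ} (ht : 0 ≤ t) :
    (√(2 * Real.pi))⁻¹ * Real.exp (-(t + √v) ^ 2 / (2 * v)) ≤
      (gaussianReal 0 v).real (Set.Ici t) := by
  have hv' : (0 : ℝ) < v := by positivity
  have hs : 0 < √(v : ℝ) := Real.sqrt_pos.2 hv'
  have h1 : (gaussianReal 0 v).real (Set.Icc t (t + √v)) ≤ (gaussianReal 0 v).real (Set.Ici t) :=
    measureReal_mono Set.Icc_subset_Ici_self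
  refine le_trans ?_ h1
  rw [measureReal_def, gaussianReal_apply_eq_integral 0 hv,
    ENNReal.toReal_ofReal (integral_nonneg fun x => gaussianPDFReal_nonneg 0 v x)]
  have h2 := setIntegral_ge_of_const_le_real (μ := volume)
    (s := Set.Icc t (t + √v)) (f := gaussianPDFReal 0 v)
    (c := (√(2 * Real.pi * v))⁻¹ * Real.exp (-(t + √v) ^ 2 / (2 * v))) measurableSet_Icc
    (by simp) (fun x hx => ?_) (integrable_gaussianPDFReal 0 v).integrableOn
  · refine le_trans (le_of_eq ?_) h2
    rw [Real.volume_real_Icc_of_le (by linarith), Real.sqrt_mul (by positivity : 0 ≤ 2 * Real.pi) v]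
    field_simp
    ring
  · rw [gaussianPDFReal_def]
    dsimp only
    have : x ^ 2 ≤ (t + √v) ^ 2 := by
      apply pow_le_pow_left₀ (ht.trans hx.1) hx.2
    rw [sub_zero]
    gcongr

lemma levelLaw_Ici_ge {a : Finset (Fin n) → ℝ} {J : Finset (Fin n)} (haJ : 0 < a J) {b : ℝ}
    (hb : 0 ≤ b) {δ : ℝ} (hδ : 0 < δ) :
    ∀ᶠ N : ℕ in atTop, Real.exp (-(N * (a J * b ^ 2 / 2 + δ))) ≤
      (levelLaw a N J).real (Set.Ici (a J * b * N)) := by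
  -- The exponent exceeds `N a_J b² / 2` by at most `b √a_J √N + K`, which is below `δ N` for large
  -- `N`.
  set K := |Real.log (√(2 * Real.pi))⁻¹| + 1 / 2 with hK
  have h1 : Tendsto (fun N : ℕ => √(N : ℝ)) atTop atTop :=
    Real.tendsto_sqrt_atTop.comp tendsto_natCast_atTop_atTop
  filter_upwards [h1.eventually_ge_atTop ((b * √(a J) + K) / δ), h1.eventually_ge_atTop 1,
    eventually_gt_atTop 0] with N hN hN1 hN0
  have hN0' : (0 : ℝ) < N := by exact_mod_cast hN0
  have hv : Real.toNNReal (a J * N) ≠ 0 := by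
    rw [Ne, Real.toNNReal_eq_zero, not_le]; positivity
  refine le_trans ?_ (gaussianReal_Ici_ge hv (by positivity : 0 ≤ a J * b * N))
  have hpi : 0 < (√(2 * Real.pi))⁻¹ := by positivity
  rw [Real.coe_toNNReal _ (by positivity), ← Real.exp_log hpi, ← Real.exp_add, Real.exp_le_exp,
    Real.sqrt_mul haJ.le]
  set r := √(N : ℝ)
  set s := √(a J)
  have hr : r ^ 2 = N := Real.sq_sqrt hN0'.le
  have hs : s ^ 2 = a J := Real.sq_sqrt haJ.le
  have hs0 : 0 < s := Real.sqrt_pos.2 haJ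
  have h2 : -(a J * b * N + s * r) ^ 2 / (2 * (a J * N)) = -(b * s * r + 1) ^ 2 / 2 := by
    rw [← hr, ← hs]; field_simp
  rw [h2, ← hr, ← hs]
  rw [div_le_iff₀ hδ] at hN
  have h3 := neg_abs_le (Real.log (√(2 * Real.pi))⁻¹)
  have h4 : K ≤ K * r := le_mul_of_one_le_right (by positivity) hN1
  have h5 : (b * s + K) * r ≤ r * δ * r := by gcongr
  have h6 : b * s * r + K ≤ r ^ 2 * δ := by nlinarith
  have h7 : (b * s * r + 1) ^ 2 / 2 = r ^ 2 * (s ^ 2 * b ^ 2 / 2) + b * s * r + 1 / 2 := by ring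
  rw [neg_div, h7, hK] at *
  nlinarith

/-! ### Second moment of the number of exceedances -/

/-- The normalised indicator of the event that a variable of level `J` exceeds `t_J`. -/
def levelIndicator (a : Finset (Fin n) → ℝ) (N : ℕ) (t : Finset (Fin n) → ℝ)
    (J : Finset (Fin n)) : ℝ → ℝ :=
  (Set.Ici (t J)).indicator fun _ => ((levelLaw a N J).real (Set.Ici (t J)))⁻¹

/-- The normalised number of configurations whose level variables exceed the thresholds. -/
def exceedance (a : Finset (Fin n) → ℝ) (m : Fin n → ℕ) (N : ℕ) (t : Finset (Fin n) → ℝ)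
    (x : Site a m → ℝ) : ℝ :=
  (∑ σ : Config m, ∏ J, levelIndicator a N t J.1 (x (siteOf σ J))) / (Fintype.card (Config m) : ℝ)

lemma levelIndicator_mul_self (a : Finset (Fin n) → ℝ) (N : ℕ) (t : Finset (Fin n) → ℝ)
    (J : Finset (Fin n)) (y : ℝ) :
    levelIndicator a N t J y * levelIndicator a N t J y = (Set.Ici (t J)).indicator
      (fun _ => ((levelLaw a N J).real (Set.Ici (t J)))⁻¹ ^ 2) y := by
  by_cases h : y ∈ Set.Ici (t J) <;> simp [levelIndicator, h, sq]

lemma integrable_levelIndicator (a : Finset (Fin n) → ℝ) (N : ℕ) (t : Finset (Fin n) → ℝ)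
    (J : Finset (Fin n)) : Integrable (levelIndicator a N t J) (levelLaw a N J) :=
  (integrable_const _).indicator measurableSet_Ici

lemma integrable_levelIndicator_mul_self (a : Finset (Fin n) → ℝ) (N : ℕ)
    (t : Finset (Fin n) → ℝ) (J : Finset (Fin n)) :
    Integrable (fun y => levelIndicator a N t J y * levelIndicator a N t J y)
      (levelLaw a N J) := by
  simp only [levelIndicator_mul_self]
  exact (integrable_const _).indicator measurableSet_Ici

lemma integral_levelIndicator {a : Finset (Fin n) → ℝ} {N : ℕ} {t : Finset (Fin n) → ℝ}
    {J : Finset (Fin n)} (h : (levelLaw a N J).real (Set.Ici (t J)) ≠ 0) :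
    ∫ y, levelIndicator a N t J y ∂(levelLaw a N J) = 1 := by
  rw [levelIndicator, integral_indicator_const _ measurableSet_Ici, smul_eq_mul, mul_inv_cancel₀ h]

lemma integral_levelIndicator_mul_self {a : Finset (Fin n) → ℝ} {N : ℕ}
    {t : Finset (Fin n) → ℝ} {J : Finset (Fin n)}
    (h : (levelLaw a N J).real (Set.Ici (t J)) ≠ 0) :
    ∫ y, levelIndicator a N t J y * levelIndicator a N t J y ∂(levelLaw a N J) =
      ((levelLaw a N J).real (Set.Ici (t J)))⁻¹ := by
  simp only [levelIndicator_mul_self]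
  rw [integral_indicator_const _ measurableSet_Ici, smul_eq_mul]
  field_simp

lemma integrable_exceedance (a : Finset (Fin n) → ℝ) (m : Fin n → ℕ) (N : ℕ)
    (t : Finset (Fin n) → ℝ) : Integrable (exceedance a m N t) (fieldLaw a m N) := by
  refine (integrable_finsetSum _ fun σ _ => ?_).div_const _
  simpa using integrable_prod_siteOf_mul (a := a) (m := m) N (g := levelIndicator a N t)
    (h := fun _ _ => 1) σ σ (integrable_levelIndicator a N t) (fun J => by simp)
    (fun J => by simp only [mul_one]; exact integrable_levelIndicator a N t J)

lemma integral_exceedance {a : Finset (Fin n) → ℝ} {m : Fin n → ℕ} (hm : ∀ i, 0 < m i) {N : ℕ}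
    {t : Finset (Fin n) → ℝ}
    (hp : ∀ J ∈ posSets a Finset.univ, (levelLaw a N J).real (Set.Ici (t J)) ≠ 0) :
    ∫ x, exceedance a m N t x ∂(fieldLaw a m N) = 1 := by
  simp only [exceedance]
  have h1 : ∀ σ : Config m, Integrable
      (fun x : Site a m → ℝ => ∏ J, levelIndicator a N t J.1 (x (siteOf σ J)))
      (fieldLaw a m N) := fun σ => by
    simpa using integrable_prod_siteOf_mul (a := a) (m := m) N (g := levelIndicator a N t)
      (h := fun _ _ => 1) σ σ (integrable_levelIndicator a N t) (fun J => by simp)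
      (fun J => by simp only [mul_one]; exact integrable_levelIndicator a N t J)
  have h2 : ∀ σ : Config m, ∫ x : Site a m → ℝ, ∏ J, levelIndicator a N t J.1 (x (siteOf σ J))
      ∂(fieldLaw a m N) = 1 := fun σ => by
    have := integral_prod_siteOf_mul (a := a) (m := m) N (levelIndicator a N t)
      (fun _ _ => 1) σ σ
    simp only [mul_one, Finset.prod_const_one, implies_true, if_true] at this
    rw [this]
    exact Finset.prod_eq_one fun J _ => integral_levelIndicator (hp J.1 J.2)
  rw [integral_div, integral_finsetSum _ fun σ _ => h1 σ]
  simp only [h2]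
  rw [Finset.sum_const, Finset.card_univ, nsmul_eq_mul, mul_one]
  exact div_self (card_config_pos hm).ne'

lemma exceedance_sq (a : Finset (Fin n) → ℝ) (m : Fin n → ℕ) (N : ℕ) (t : Finset (Fin n) → ℝ)
    (x : Site a m → ℝ) :
    exceedance a m N t x ^ 2 = (∑ σ : Config m, ∑ σ' : Config m,
      (∏ J, levelIndicator a N t J.1 (x (siteOf σ J))) *
        ∏ J, levelIndicator a N t J.1 (x (siteOf σ' J))) / (Fintype.card (Config m) : ℝ) ^ 2 := by
  rw [exceedance, div_pow, sq (∑ σ : Config m, _), Finset.sum_mul_sum]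

lemma integrable_exceedance_sq (a : Finset (Fin n) → ℝ) (m : Fin n → ℕ) (N : ℕ)
    (t : Finset (Fin n) → ℝ) :
    Integrable (fun x => exceedance a m N t x ^ 2) (fieldLaw a m N) := by
  simp only [exceedance_sq]
  exact (integrable_finsetSum _ fun σ _ => integrable_finsetSum _ fun σ' _ =>
    integrable_prod_siteOf_mul N σ σ' (integrable_levelIndicator a N t)
      (integrable_levelIndicator a N t) (integrable_levelIndicator_mul_self a N t)).div_const _

lemma empty_notMem_posSets {a : Finset (Fin n) → ℝ} (ha_empty : a ∅ = 0)
    {A J : Finset (Fin n)} (hJ : J ∈ posSets a A) : J ≠ ∅ := by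
  rintro rfl
  simp [posSets, ha_empty] at hJ

open Classical in
-- A pair agreeing exactly on `D` contributes the product of the inverse tail probabilities of the
-- levels inside `D`. For `D = ∅` this is 1, because `a ∅ = 0` leaves no common level. For `D ≠ ∅`
-- it is bounded by the sum over all nonempty `A` on which the pair agrees, and such pairs have
-- frequency `1 / ∏_{i ∈ A} m_i`.
lemma integral_exceedance_sq_le {a : Finset (Fin n) → ℝ} (ha_empty : a ∅ = 0) {m : Fin n → ℕ}
    (hm : ∀ i, 0 < m i) {N : ℕ} {t : Finset (Fin n) → ℝ}
    (hp : ∀ J ∈ posSets a Finset.univ, 0 < (levelLaw a N J).real (Set.Ici (t J))) :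
    ∫ x, exceedance a m N t x ^ 2 ∂(fieldLaw a m N) ≤
      1 + ∑ A ∈ Finset.univ.erase (∅ : Finset (Fin n)),
        (∏ J ∈ posSets a A, ((levelLaw a N J).real (Set.Ici (t J)))⁻¹) /
          ∏ i ∈ A, (m i : ℝ) := by
  set p : Finset (Fin n) → ℝ := fun J => (levelLaw a N J).real (Set.Ici (t J)) with hpdef
  set R : Finset (Fin n) → ℝ := fun A => ∏ J ∈ posSets a A, (p J)⁻¹ with hR
  have hpos : ∀ {A J}, J ∈ posSets a A → 0 < p J := fun {A J} hJ => hp J (by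
    simp only [posSets, Finset.mem_filter, Finset.mem_powerset] at hJ ⊢
    exact ⟨Finset.subset_univ _, hJ.2⟩)
  have hR0 : ∀ A, 0 ≤ R A := fun A =>
    Finset.prod_nonneg fun J hJ => inv_nonneg.2 (hpos hJ).le
  have hterm : ∀ σ σ' : Config m, ∫ x : Site a m → ℝ,
      (∏ J, levelIndicator a N t J.1 (x (siteOf σ J))) *
        ∏ J, levelIndicator a N t J.1 (x (siteOf σ' J)) ∂(fieldLaw a m N) ≤
      1 + ∑ A ∈ Finset.univ.erase (∅ : Finset (Fin n)),
        if ∀ i ∈ A, σ i = σ' i then R A else 0 := by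
    intro σ σ'
    set D : Finset (Fin n) := Finset.univ.filter fun i => σ i = σ' i with hD
    have h1 : ∫ x : Site a m → ℝ,
      (∏ J, levelIndicator a N t J.1 (x (siteOf σ J))) *
        ∏ J, levelIndicator a N t J.1 (x (siteOf σ' J)) ∂(fieldLaw a m N) = R D := by
      rw [integral_prod_siteOf_mul]
      have h2 : ∀ J : {J // J ∈ posSets a Finset.univ},
          (if ∀ i ∈ J.1, σ i = σ' i then
            ∫ y, levelIndicator a N t J.1 y * levelIndicator a N t J.1 y ∂(levelLaw a N J.1)
          else (∫ y, levelIndicator a N t J.1 y ∂(levelLaw a N J.1)) *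
            ∫ y, levelIndicator a N t J.1 y ∂(levelLaw a N J.1)) =
          if J.1 ⊆ D then (p J.1)⁻¹ else 1 := by
        intro J
        rw [integral_levelIndicator (hp J.1 J.2).ne',
          integral_levelIndicator_mul_self (hp J.1 J.2).ne', mul_one]
        refine if_congr ?_ rfl rfl
        simp [hD, Finset.subset_iff]
      simp only [h2]
      rw [Finset.prod_coe_sort (posSets a Finset.univ) fun J => if J ⊆ D then (p J)⁻¹ else 1,
        ← Finset.prod_filter]
      refine Finset.prod_congr ?_ fun _ _ => rfl
      ext J
      simp [posSets, and_comm]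
    rw [h1]
    have hnn : ∀ A : Finset (Fin n), 0 ≤ if ∀ i ∈ A, σ i = σ' i then R A else 0 := fun A => by
      split_ifs; exacts [hR0 A, le_rfl]
    by_cases hDe : D = ∅
    · have h3 : R D = 1 := by
        rw [hDe]
        refine Finset.prod_eq_one fun J hJ => ?_
        exact absurd (Finset.subset_empty.1 (Finset.mem_powerset.1 (Finset.mem_filter.1 hJ).1))
          (empty_notMem_posSets ha_empty hJ)
      rw [h3]
      exact le_add_of_nonneg_right (Finset.sum_nonneg fun A _ => hnn A)
    · have h3 := Finset.single_le_sum (f := fun A => if ∀ i ∈ A, σ i = σ' i then R A else 0)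
        (fun A _ => hnn A) (Finset.mem_erase.2 ⟨hDe, Finset.mem_univ D⟩)
      have h4 : ∀ i ∈ D, σ i = σ' i := fun i hi => (Finset.mem_filter.1 hi).2
      simp only [if_pos h4] at h3
      linarith
  have hC := card_config_pos hm
  simp only [exceedance_sq]
  rw [integral_div, integral_finsetSum _ fun σ _ => integrable_finsetSum _ fun σ' _ =>
    integrable_prod_siteOf_mul N σ σ' (integrable_levelIndicator a N t)
      (integrable_levelIndicator a N t) (integrable_levelIndicator_mul_self a N t),
    div_le_iff₀ (by positivity)]
  have hcount : ∀ A : Finset (Fin n), ∀ σ : Config m,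
      ∑ σ' : Config m, (if ∀ i ∈ A, σ i = σ' i then R A else 0) =
        R A / (∏ i ∈ A, (m i : ℝ)) * Fintype.card (Config m) := by
    intro A σ
    rw [← Finset.sum_filter, Finset.sum_const, nsmul_eq_mul]
    have h3 : (0 : ℝ) < ∏ i ∈ A, (m i : ℝ) :=
      Finset.prod_pos fun i _ => by exact_mod_cast hm i
    have h2 : ((Finset.univ.filter fun σ' : Config m => ∀ i ∈ A, σ i = σ' i).card : ℝ) *
        ∏ i ∈ A, (m i : ℝ) = Fintype.card (Config m) := by
      exact_mod_cast card_agree_mul A σ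
    rw [← h2]
    field_simp
  calc _ ≤ ∑ σ : Config m, ∑ σ' : Config m, (1 + ∑ A ∈ Finset.univ.erase (∅ : Finset (Fin n)),
        if ∀ i ∈ A, σ i = σ' i then R A else 0) := by
        refine Finset.sum_le_sum fun σ _ => ?_
        rw [integral_finsetSum _ fun σ' _ =>
          integrable_prod_siteOf_mul N σ σ' (integrable_levelIndicator a N t)
          (integrable_levelIndicator a N t) (integrable_levelIndicator_mul_self a N t)]
        exact Finset.sum_le_sum fun σ' _ => hterm σ σ'
    _ = _ := by
        have h5 : ∀ σ : Config m, ∑ σ' : Config m, (1 +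
            ∑ A ∈ Finset.univ.erase (∅ : Finset (Fin n)),
              if ∀ i ∈ A, σ i = σ' i then R A else 0) =
            (1 + ∑ A ∈ Finset.univ.erase (∅ : Finset (Fin n)), R A / ∏ i ∈ A, (m i : ℝ)) *
              Fintype.card (Config m) := by
          intro σ
          rw [Finset.sum_add_distrib, Finset.sum_comm, Finset.sum_congr rfl fun A _ => hcount A σ,
            ← Finset.sum_mul, Finset.sum_const, Finset.card_univ]
          simp only [nsmul_eq_mul, mul_one]
          ring
        simp only [h5]
        rw [Finset.sum_const, Finset.card_univ, nsmul_eq_mul]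
        ring

/-- For `β ≥ 0` a counted configuration has Boltzmann weight at least `∏ exp(β t_J)`; the tail
probabilities undo the normalisation of the indicators. -/
lemma exceedance_mul_le {a : Finset (Fin n) → ℝ} {m : Fin n → ℕ} (hm : ∀ i, 0 < m i) {N : ℕ}
    {t : Finset (Fin n) → ℝ} {β : ℝ} (hβ : 0 ≤ β)
    (hp : ∀ J ∈ posSets a Finset.univ, 0 < (levelLaw a N J).real (Set.Ici (t J)))
    (x : Site a m → ℝ) :
    exceedance a m N t x * ∏ J ∈ posSets a Finset.univ,
        ((levelLaw a N J).real (Set.Ici (t J)) * Real.exp (β * t J)) ≤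
      averagedWeight a m (fun _ => β) x := by
  rw [exceedance, averagedWeight, div_mul_eq_mul_div, Finset.sum_mul]
  refine div_le_div_of_nonneg_right (Finset.sum_le_sum fun σ _ => ?_) (card_config_pos hm).le
  rw [weightedEnergy, Real.exp_sum, ← Finset.prod_coe_sort (posSets a Finset.univ) fun J =>
    (levelLaw a N J).real (Set.Ici (t J)) * Real.exp (β * t J), ← Finset.prod_mul_distrib]
  have h0 : ∀ J : {J // J ∈ posSets a Finset.univ},
      0 ≤ levelIndicator a N t J.1 (x (siteOf σ J)) := fun J =>
    Set.indicator_nonneg (fun _ _ => inv_nonneg.2 (hp J.1 J.2).le) _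
  refine Finset.prod_le_prod (fun J _ => mul_nonneg (h0 J)
    (mul_nonneg (hp J.1 J.2).le (Real.exp_pos _).le)) fun J _ => ?_
  by_cases h : x (siteOf σ J) ∈ Set.Ici (t J)
  · rw [levelIndicator, Set.indicator_of_mem h, inv_mul_cancel_left₀ (hp J.1 J.2).ne']
    exact Real.exp_le_exp.2 (mul_le_mul_of_nonneg_left h hβ)
  · rw [levelIndicator, Set.indicator_of_notMem h, zero_mul]
    exact (Real.exp_pos _).le

lemma card_posSets_le (a : Finset (Fin n) → ℝ) (A : Finset (Fin n)) :
    ((posSets a A).card : ℝ) ≤ Fintype.card (Finset (Fin n)) := by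
  exact_mod_cast Finset.card_le_univ _

/-- Chebyshev's inequality around the mean 1, with a variance of at most `2^n r`; the 4 is
`(1/2)⁻²`. -/
lemma exceedance_lower_tail {a : Finset (Fin n) → ℝ} (ha_empty : a ∅ = 0) {m : Fin n → ℕ}
    (hm : ∀ i, 0 < m i) {N : ℕ} {t : Finset (Fin n) → ℝ}
    (hp : ∀ J ∈ posSets a Finset.univ, 0 < (levelLaw a N J).real (Set.Ici (t J)))
    {r : ℝ} (hr : 0 ≤ r) (h : ∀ A : Finset (Fin n), A ≠ ∅ →
      (∏ J ∈ posSets a A, ((levelLaw a N J).real (Set.Ici (t J)))⁻¹) / ∏ i ∈ A, (m i : ℝ) ≤ r) :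
    (fieldLaw a m N).real {x | exceedance a m N t x < 1 / 2} ≤
      4 * Fintype.card (Finset (Fin n)) * r := by
  classical
  set μ := fieldLaw a m N
  have h1 := integral_exceedance_sq_le ha_empty hm hp
  have h2 : ∑ A ∈ Finset.univ.erase (∅ : Finset (Fin n)),
      (∏ J ∈ posSets a A, ((levelLaw a N J).real (Set.Ici (t J)))⁻¹) / ∏ i ∈ A, (m i : ℝ) ≤
      Fintype.card (Finset (Fin n)) * r := by
    refine (Finset.sum_le_card_nsmul _ _ r fun A hA => h A (Finset.ne_of_mem_erase hA)).trans ?_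
    rw [nsmul_eq_mul]
    gcongr
    exact Finset.card_le_univ _
  have hi1 := integrable_exceedance a m N t
  have hi2 := integrable_exceedance_sq a m N t
  have hi3 : Integrable (fun x => (exceedance a m N t x - 1) ^ 2) μ := by
    have : (fun x => (exceedance a m N t x - 1) ^ 2) =
        fun x => exceedance a m N t x ^ 2 - 2 * exceedance a m N t x + 1 := by
      funext x; ring
    rw [this]
    exact (hi2.sub (hi1.const_mul 2)).add (integrable_const 1)
  have h3 : ∫ x, (exceedance a m N t x - 1) ^ 2 ∂μ =
      (∫ x, exceedance a m N t x ^ 2 ∂μ) - 1 := by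
    have : ∀ x, (exceedance a m N t x - 1) ^ 2 =
        exceedance a m N t x ^ 2 - 2 * exceedance a m N t x + 1 := fun x => by ring
    simp only [this]
    have hi4 : Integrable (fun x => exceedance a m N t x ^ 2 - 2 * exceedance a m N t x) μ :=
      hi2.sub (hi1.const_mul 2)
    rw [integral_add hi4 (integrable_const 1),
      integral_sub hi2 (hi1.const_mul 2), integral_const_mul,
      integral_exceedance hm fun J hJ => (hp J hJ).ne']
    simp
    ring
  have h4 := mul_meas_ge_le_integral_of_nonneg (μ := μ)
    (ae_of_all _ fun x => sq_nonneg (exceedance a m N t x - 1)) hi3 (1 / 4)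
  have h5 : μ.real {x | exceedance a m N t x < 1 / 2} ≤
      μ.real {x | 1 / 4 ≤ (exceedance a m N t x - 1) ^ 2} := by
    refine measureReal_mono fun x hx => ?_
    have hx' : exceedance a m N t x < 1 / 2 := hx
    change 1 / 4 ≤ (exceedance a m N t x - 1) ^ 2
    nlinarith
  linarith

lemma freeEnergy_lower_tail_of_lt {a : Finset (Fin n) → ℝ} (ha_empty : a ∅ = 0) {γ : Fin n → ℝ} {M : ℕ → Fin n → ℕ} (hM_pos : ∀ N i, 0 < M N i)
    (hM : ∀ i, Tendsto (fun N : ℕ => Real.logb 2 (M N i) / (N : ℝ)) atTop (𝓝 (γ i)))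
    {β : ℝ} (hβ : 0 ≤ β) {b : Finset (Fin n) → ℝ} (hb : ∀ J, 0 ≤ b J)
    (hlt : ∀ A, A ≠ ∅ → budget a b A < gam γ A * Real.log 2) {ε : ℝ} (hε : 0 < ε) :
    ∃ c > 0, ∀ᶠ N : ℕ in atTop, (fieldLaw a (M N) N).real
      {x | freeEnergy N β (hamiltonian a (M N) x) < value a β b - ε} ≤ Real.exp (-(c * N)) := by
  classical
  -- Of the slack `3 κ`, one `κ` pays for the cardinalities and one for the Gaussian tails; the
  -- third is the decay rate.
  obtain ⟨κ, hκ, hslack⟩ : ∃ κ > 0, ∀ A : Finset (Fin n), A ≠ ∅ →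
      budget a b A + 3 * κ ≤ gam γ A * Real.log 2 := by
    have : ∀ᶠ κ : ℝ in 𝓝[>] 0, ∀ A : Finset (Fin n), A ≠ ∅ →
        budget a b A + 3 * κ ≤ gam γ A * Real.log 2 := by
      refine eventually_all.2 fun A => ?_
      by_cases hA : A = ∅
      · simp [hA]
      have h1 : Tendsto (fun κ : ℝ => budget a b A + 3 * κ) (𝓝[>] 0) (𝓝 (budget a b A + 3 * 0)) :=
        Tendsto.mono_left (Continuous.tendsto (by fun_prop) 0) nhdsWithin_le_nhds
      have h2 := h1.eventually_lt_const (u := gam γ A * Real.log 2) (by simpa using hlt A hA)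
      filter_upwards [h2] with κ hκ _ using hκ.le
    obtain ⟨κ, h1, h2⟩ := (this.and self_mem_nhdsWithin).exists
    exact ⟨κ, h2, h1⟩
  set C : ℝ := ((Fintype.card (Finset (Fin n)) : ℕ) : ℝ) with hC
  have hC0 : 0 < C := by rw [hC]; exact_mod_cast Fintype.card_pos
  -- An error `δ` per level, over at most `C` levels, stays below both `κ` and `ε / 2`.
  set δ := min κ (ε / 2) / C with hδ
  have hδ0 : 0 < δ := by positivity
  have hδκ : C * δ ≤ κ := by rw [hδ, mul_div_cancel₀ _ hC0.ne']; exact min_le_left _ _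
  have hδε : C * δ ≤ ε / 2 := by rw [hδ, mul_div_cancel₀ _ hC0.ne']; exact min_le_right _ _
  refine ⟨κ / 2, by positivity, ?_⟩
  have h1 : ∀ᶠ N : ℕ in atTop, ∀ A : Finset (Fin n),
      gam γ A * Real.log 2 - κ < Real.log (∏ i ∈ A, (M N i : ℝ)) / N :=
    eventually_all.2 fun A => (tendsto_log_card hM_pos hM A).eventually_const_lt (by linarith)
  have h2 : ∀ᶠ N : ℕ in atTop, ∀ J ∈ posSets a Finset.univ,
      Real.exp (-(N * (a J * b J ^ 2 / 2 + δ))) ≤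
        (levelLaw a N J).real (Set.Ici (a J * b J * N)) :=
    (Finset.eventually_all _).2 fun J hJ =>
      levelLaw_Ici_ge (Finset.mem_filter.1 hJ).2 (hb J) hδ0
  -- This pays for the factor `1/2` in `exceedance ≥ 1/2`.
  have h3 : ∀ᶠ N : ℕ in atTop, Real.log 2 ≤ N * (ε / 2) :=
    (Tendsto.atTop_mul_const (by positivity) tendsto_natCast_atTop_atTop).eventually_ge_atTop _
  filter_upwards [h1, h2, h3, eventually_const_mul_exp_le (4 * C) hκ, eventually_gt_atTop 0]
    with N hN1 hN2 hN3 hN4 hN0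
  have hN0' : (0 : ℝ) < N := by exact_mod_cast hN0
  set t : Finset (Fin n) → ℝ := fun J => a J * b J * N with ht
  have hp : ∀ J ∈ posSets a Finset.univ, 0 < (levelLaw a N J).real (Set.Ici (t J)) :=
    fun J hJ => (Real.exp_pos _).trans_le (hN2 J hJ)
  have hsubset : ∀ A : Finset (Fin n), posSets a A ⊆ posSets a Finset.univ := fun A =>
    Finset.filter_subset_filter _ (Finset.powerset_mono.2 (Finset.subset_univ A))
  refine le_trans ?_ hN4
  refine le_trans ?_ (exceedance_lower_tail ha_empty (hM_pos N) hp (Real.exp_pos _).le ?_)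
  · refine measureReal_mono fun x hx => ?_
    change freeEnergy N β (hamiltonian a (M N) x) < value a β b - ε at hx
    change exceedance a (M N) N t x < 1 / 2
    by_contra hcon
    rw [not_lt] at hcon
    refine absurd hx (not_lt.2 ?_)
    rw [freeEnergy, partitionFunction_hamiltonian, one_div, le_inv_mul_iff₀ hN0',
      Real.le_log_iff_exp_le (averagedWeight_pos (hM_pos N) _ _)]
    refine le_trans ?_ (exceedance_mul_le (hM_pos N) hβ hp x)
    have h4 : Real.exp (∑ J ∈ posSets a Finset.univ,
        (-(N * (a J * b J ^ 2 / 2 + δ)) + β * t J)) ≤ ∏ J ∈ posSets a Finset.univ,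
        ((levelLaw a N J).real (Set.Ici (t J)) * Real.exp (β * t J)) := by
      rw [Real.exp_sum]
      refine Finset.prod_le_prod (fun _ _ => (Real.exp_pos _).le) fun J hJ => ?_
      rw [Real.exp_add]
      exact mul_le_mul_of_nonneg_right (hN2 J hJ) (Real.exp_pos _).le
    have h5 : Real.exp (-Real.log 2) = 1 / 2 := by
      rw [Real.exp_neg, Real.exp_log two_pos]; norm_num
    calc Real.exp (N * (value a β b - ε)) ≤ Real.exp (-Real.log 2 +
          ∑ J ∈ posSets a Finset.univ, (-(N * (a J * b J ^ 2 / 2 + δ)) + β * t J)) := by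
          rw [Real.exp_le_exp]
          have h6 : ∑ J ∈ posSets a Finset.univ, (-(N * (a J * b J ^ 2 / 2 + δ)) + β * t J) =
              N * (value a β b - (posSets a Finset.univ).card * δ) := by
            rw [value, mul_sub, ← nsmul_eq_mul (posSets a Finset.univ).card, ← Finset.sum_const, Finset.mul_sum,
              Finset.mul_sum, ← Finset.sum_sub_distrib]
            refine Finset.sum_congr rfl fun J _ => ?_
            rw [ht]; ring
          rw [h6]
          have h7 : (posSets a Finset.univ).card * δ ≤ ε / 2 :=
            (mul_le_mul_of_nonneg_right (card_posSets_le a _) hδ0.le).trans hδε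
          nlinarith
      _ ≤ _ := by
          rw [Real.exp_add, h5]
          exact mul_le_mul hcon h4 (Real.exp_pos _).le (by linarith)
  · intro A hA
    have hprod : (0 : ℝ) < ∏ i ∈ A, (M N i : ℝ) :=
      Finset.prod_pos fun i _ => by exact_mod_cast hM_pos N i
    rw [div_le_iff₀ hprod]
    have h4 : ∏ J ∈ posSets a A, ((levelLaw a N J).real (Set.Ici (t J)))⁻¹ ≤
        Real.exp (N * (budget a b A + κ)) := by
      calc _ ≤ ∏ J ∈ posSets a A, Real.exp (N * (a J * b J ^ 2 / 2 + δ)) := by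
            refine Finset.prod_le_prod (fun J hJ => inv_nonneg.2 (hp J (hsubset A hJ)).le)
              fun J hJ => ?_
            rw [inv_le_comm₀ (hp J (hsubset A hJ)) (Real.exp_pos _), ← Real.exp_neg]
            exact hN2 J (hsubset A hJ)
        _ ≤ _ := by
            rw [← Real.exp_sum, Real.exp_le_exp, ← Finset.mul_sum, Finset.sum_add_distrib,
              Finset.sum_const, nsmul_eq_mul, ← budget]
            gcongr
            exact (mul_le_mul_of_nonneg_right (card_posSets_le a A) hδ0.le).trans hδκ
    refine h4.trans ?_
    rw [← Real.exp_log hprod, ← Real.exp_add, Real.exp_le_exp]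
    have h5 := (lt_div_iff₀ hN0').1 (hN1 A)
    have h6 := hslack A hA
    nlinarith

/-- Scaling `b` by `s < 1` multiplies every budget by `s²`, which makes the constraints strict for
`A ≠ ∅` since `γ(A) > 0`; the value is continuous in `s`. -/
lemma freeEnergy_lower_tail {a : Finset (Fin n) → ℝ} (ha_empty : a ∅ = 0) {γ : Fin n → ℝ} (hγ : ∀ i, 0 < γ i) {M : ℕ → Fin n → ℕ}
    (hM_pos : ∀ N i, 0 < M N i)
    (hM : ∀ i, Tendsto (fun N : ℕ => Real.logb 2 (M N i) / (N : ℝ)) atTop (𝓝 (γ i)))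
    {β : ℝ} (hβ : 0 ≤ β) {b : Finset (Fin n) → ℝ} (hb : IsFeasible a γ b)
    {ε : ℝ} (hε : 0 < ε) :
    ∃ c > 0, ∀ᶠ N : ℕ in atTop, (fieldLaw a (M N) N).real
      {x | freeEnergy N β (hamiltonian a (M N) x) < value a β b - ε} ≤ Real.exp (-(c * N)) := by
  have h1 : Tendsto (fun s : ℝ => value a β fun J => s * b J) (𝓝[<] 1)
      (𝓝 (value a β fun J => 1 * b J)) := by
    refine Tendsto.mono_left (Continuous.tendsto ?_ 1) nhdsWithin_le_nhds
    unfold value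
    fun_prop
  simp only [one_mul] at h1
  have h2 := h1.eventually_const_lt (u := value a β b - ε / 2) (by linarith)
  obtain ⟨s, hs1, hs0, hs2⟩ := (h2.and (Ioo_mem_nhdsLT zero_lt_one)).exists
  have h3 : ∀ A, budget a (fun J => s * b J) A = s ^ 2 * budget a b A := fun A => by
    simp only [budget, Finset.mul_sum]
    exact Finset.sum_congr rfl fun J _ => by ring
  have hlt : ∀ A, A ≠ ∅ → budget a (fun J => s * b J) A < gam γ A * Real.log 2 := by
    intro A hA
    rw [h3]
    have h4 : 0 < gam γ A * Real.log 2 :=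
      mul_pos (Finset.sum_pos (fun i _ => hγ i) (Finset.nonempty_iff_ne_empty.2 hA))
        (Real.log_pos one_lt_two)
    have h5 := mul_le_mul_of_nonneg_left (hb.budget_le A) (sq_nonneg s)
    have h6 : s ^ 2 < 1 := by nlinarith
    nlinarith
  obtain ⟨c, hc, h⟩ := freeEnergy_lower_tail_of_lt ha_empty hM_pos hM hβ
    (b := fun J => s * b J) (fun J => mul_nonneg hs0.le (hb.nonneg J)) hlt (half_pos hε)
  refine ⟨c, hc, h.mono fun N hN => (measureReal_mono fun x hx => ?_).trans hN⟩
  have hx' : freeEnergy N β (hamiltonian a (M N) x) < value a β b - ε := hx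
  change freeEnergy N β (hamiltonian a (M N) x) < value a β (fun J => s * b J) - ε / 2
  linarith

/-! ### Convergence of the free energy -/

lemma freeEnergy_hamiltonian_neg (a : Finset (Fin n) → ℝ) (m : Fin n → ℕ) (N : ℕ) (β : ℝ)
    (x : Site a m → ℝ) :
    freeEnergy N β (hamiltonian a m (-x)) = freeEnergy N (-β) (hamiltonian a m x) := by
  simp only [freeEnergy, partitionFunction, hamiltonian, Pi.neg_apply, Finset.sum_neg_distrib,
    mul_neg, neg_mul]

lemma measurable_freeEnergy (a : Finset (Fin n) → ℝ) (m : Fin n → ℕ) (N : ℕ) (β : ℝ) :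
    Measurable fun x : Site a m → ℝ => freeEnergy N β (hamiltonian a m x) := by
  unfold freeEnergy partitionFunction hamiltonian
  fun_prop

lemma measureReal_freeEnergy_neg (a : Finset (Fin n) → ℝ) (m : Fin n → ℕ) (N : ℕ) (β : ℝ)
    {s : Set ℝ} :
    (fieldLaw a m N).real {x | freeEnergy N (-β) (hamiltonian a m x) ∈ s} =
      (fieldLaw a m N).real {x | freeEnergy N β (hamiltonian a m x) ∈ s} := by
  simp only [← freeEnergy_hamiltonian_neg]
  rw [measureReal_def, measureReal_def]
  congr 1
  exact Measure.measure_preimage_neg (fieldLaw a m N)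
    {x | freeEnergy N β (hamiltonian a m x) ∈ s}

lemma freeEnergy_tail {a : Finset (Fin n) → ℝ} (ha : ∀ J, 0 ≤ a J)
    (ha_empty : a ∅ = 0) {γ : Fin n → ℝ} (hγ : ∀ i, 0 < γ i) {M : ℕ → Fin n → ℕ}
    (hM_pos : ∀ N i, 0 < M N i)
    (hM : ∀ i, Tendsto (fun N : ℕ => Real.logb 2 (M N i) / (N : ℝ)) atTop (𝓝 (γ i)))
    {β : ℝ} {b lam : Finset (Fin n) → ℝ} (hb : IsFeasible a γ b) (h : IsDual a γ |β| b lam)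
    {ε : ℝ} (hε : 0 < ε) :
    ∃ c > 0, ∀ᶠ N : ℕ in atTop, (fieldLaw a (M N) N).real
      {x | ε < |freeEnergy N β (hamiltonian a (M N) x) - value a |β| b|} ≤
        Real.exp (-(c * N)) := by
  obtain ⟨c₁, hc₁, h₁⟩ := freeEnergy_upper_tail ha hM_pos hM h hε
  obtain ⟨c₂, hc₂, h₂⟩ := freeEnergy_lower_tail ha_empty hγ hM_pos hM (abs_nonneg β) hb hε
  refine ⟨min c₁ c₂ / 2, by positivity, ?_⟩
  filter_upwards [h₁, h₂, eventually_const_mul_exp_le 2 (lt_min hc₁ hc₂)] with N hN₁ hN₂ hN₃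
  -- The field is symmetric, so the free energies at `β` and `|β|` have the same law.
  have habs : (fieldLaw a (M N) N).real
      {x | ε < |freeEnergy N β (hamiltonian a (M N) x) - value a |β| b|} =
      (fieldLaw a (M N) N).real
      {x | ε < |freeEnergy N |β| (hamiltonian a (M N) x) - value a |β| b|} := by
    rcases abs_choice β with hβ | hβ
    · rw [hβ]
    · have := measureReal_freeEnergy_neg a (M N) N β (s := {y | ε < |y - value a |β| b|})
      rw [← hβ] at this
      exact this.symm
  rw [habs]
  refine le_trans ?_ hN₃
  refine (measureReal_mono (s₂ := {x | value a |β| b + ε < freeEnergy N |β|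
    (hamiltonian a (M N) x)} ∪ {x | freeEnergy N |β| (hamiltonian a (M N) x) <
      value a |β| b - ε}) fun x hx => ?_).trans ((measureReal_union_le _ _).trans ?_)
  · rcases lt_abs.1 (show ε < |_| from hx) with h3 | h3
    · exact Or.inl (show value a |β| b + ε < freeEnergy N |β| (hamiltonian a (M N) x) by linarith)
    · exact Or.inr (show freeEnergy N |β| (hamiltonian a (M N) x) < value a |β| b - ε by linarith)
  · have h3 : Real.exp (-(c₁ * N)) ≤ Real.exp (-(min c₁ c₂ * N)) := by
      gcongr; exact min_le_left _ _
    have h4 : Real.exp (-(c₂ * N)) ≤ Real.exp (-(min c₁ c₂ * N)) := by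
      gcongr; exact min_le_right _ _
    linarith

/-- Borel–Cantelli for `ε = 1 / (k + 1)`. Only summability is used, so the joint law over different
`N` plays no role. -/
lemma ae_tendsto_of_exp_tail {Ω : Type*} [MeasurableSpace Ω] {P : Measure Ω}
    [IsFiniteMeasure P] {F : ℕ → Ω → ℝ} {v : ℝ}
    (h : ∀ ε > 0, ∃ c > 0, ∀ᶠ N : ℕ in atTop, P.real {ω | ε < |F N ω - v|} ≤
      Real.exp (-(c * N))) :
    ∀ᵐ ω ∂P, Tendsto (fun N => F N ω) atTop (𝓝 v) := by
  have h1 : ∀ k : ℕ, ∀ᵐ ω ∂P, ∀ᶠ N in atTop, |F N ω - v| ≤ 1 / ((k : ℝ) + 1) := by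
    intro k
    obtain ⟨c, hc, hk⟩ := h (1 / ((k : ℝ) + 1)) (by positivity)
    have hs : Summable fun N : ℕ => P.real {ω | 1 / ((k : ℝ) + 1) < |F N ω - v|} := by
      refine Summable.of_norm_bounded_eventually_nat
        (Real.summable_exp_nat_mul_iff.2 (neg_lt_zero.2 hc)) ?_
      filter_upwards [hk] with N hN
      rw [Real.norm_of_nonneg measureReal_nonneg]
      refine hN.trans (le_of_eq ?_)
      congr 1; ring
    have := ae_eventually_notMem (μ := P)
      (s := fun N => {ω | 1 / ((k : ℝ) + 1) < |F N ω - v|}) ?_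
    · filter_upwards [this] with ω hω
      filter_upwards [hω] with N hN using not_lt.1 hN
    · have h2 := hs.tsum_ofReal_ne_top
      rwa [tsum_congr fun N => ofReal_measureReal (measure_ne_top P _)] at h2
  filter_upwards [ae_all_iff.2 h1] with ω hω
  rw [Metric.tendsto_atTop']
  intro ε hε
  obtain ⟨k, hk⟩ := exists_nat_one_div_lt hε
  obtain ⟨N₀, hN₀⟩ := eventually_atTop.1 (hω k)
  exact ⟨N₀, fun N hN => ((hN₀ N hN.le).trans_lt hk)⟩

/-! ### Uniform integrability and convergence of means -/

/-- A dominating function for the free energy, built from the partition functions at `±β`. -/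
def dominant (a : Finset (Fin n) → ℝ) (m : Fin n → ℕ) (N : ℕ) (β : ℝ) (x : Site a m → ℝ) : ℝ :=
  Real.exp (β ^ 2 / 2) * (2 + (averagedWeight a m (fun _ => β) x +
    averagedWeight a m (fun _ => -β) x) / Real.exp (N * (β ^ 2 / 2)))

lemma integrable_dominant (a : Finset (Fin n) → ℝ) (m : Fin n → ℕ) (N : ℕ) (β : ℝ) :
    Integrable (dominant a m N β) (fieldLaw a m N) :=
  ((integrable_const _).add (((integrable_averagedWeight a m N _).add
    (integrable_averagedWeight a m N _)).div_const _)).const_mul _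

lemma sum_posSets_univ {a : Finset (Fin n) → ℝ} (ha : ∀ J, 0 ≤ a J) (A : Finset (Fin n))
    (g : Finset (Fin n) → ℝ) :
    ∑ J ∈ posSets a A, a J * g J = ∑ J, if J ⊆ A then a J * g J else 0 := by
  rw [← Finset.sum_filter]
  refine Finset.sum_subset (fun J hJ => ?_) fun J hJ hJ' => ?_
  · simp only [posSets, Finset.mem_filter, Finset.mem_powerset] at hJ
    simpa using hJ.1
  · simp only [posSets, Finset.mem_filter, Finset.mem_powerset, Finset.mem_univ, true_and,
      not_and, not_lt] at hJ hJ'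
    rw [le_antisymm (hJ' hJ) (ha J), zero_mul]

/-- Since `∑ a_J = 1`, both partition functions have mean `exp(N β² / 2)`, so the factor is `2 + 1 +
1`, whatever `N` is. -/
lemma integral_dominant {a : Finset (Fin n) → ℝ} (ha : ∀ J, 0 ≤ a J) (ha_sum : ∑ J, a J = 1)
    {m : Fin n → ℕ} (hm : ∀ i, 0 < m i) (N : ℕ) (β : ℝ) :
    ∫ x, dominant a m N β x ∂(fieldLaw a m N) = 4 * Real.exp (β ^ 2 / 2) := by
  have h1 : ∀ c : ℝ, ∑ J ∈ posSets a Finset.univ, a J * c ^ 2 / 2 = c ^ 2 / 2 := fun c => by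
    simp only [mul_div_assoc]
    rw [sum_posSets_univ ha Finset.univ fun _ => c ^ 2 / 2]
    simp [← Finset.sum_mul, ha_sum]
  have hi : ∀ c : ℝ, Integrable (fun x => averagedWeight a m (fun _ => c) x) (fieldLaw a m N) :=
    fun c => integrable_averagedWeight a m N _
  have hi2 : Integrable (fun x => averagedWeight a m (fun _ => β) x +
    averagedWeight a m (fun _ => -β) x) (fieldLaw a m N) := (hi β).add (hi (-β))
  unfold dominant
  rw [integral_const_mul, integral_add (integrable_const _) (hi2.div_const _), integral_div,
    integral_add (hi β) (hi (-β)), integral_averagedWeight ha hm, integral_averagedWeight ha hm,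
    h1, h1, neg_sq]
  simp only [integral_const, probReal_univ, one_smul]
  rw [← two_mul, mul_div_assoc, div_self (Real.exp_pos _).ne']
  ring

/-- Cauchy–Schwarz. It gives `-F_N(β) ≤ F_N(-β)`, so upper bounds at `±β` control `|F_N(β)|`. -/
lemma one_le_averagedWeight_mul {a : Finset (Fin n) → ℝ} {m : Fin n → ℕ} (hm : ∀ i, 0 < m i)
    (β : ℝ) (x : Site a m → ℝ) :
    1 ≤ averagedWeight a m (fun _ => β) x * averagedWeight a m (fun _ => -β) x := by
  have h1 := Finset.sum_sq_le_sum_mul_sum_of_sq_le_mul (Finset.univ : Finset (Config m))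
    (r := fun _ => (1 : ℝ))
    (f := fun σ => Real.exp (weightedEnergy a m (fun _ => β) x σ))
    (g := fun σ => Real.exp (weightedEnergy a m (fun _ => -β) x σ))
    (fun _ _ => (Real.exp_pos _).le) (fun _ _ => (Real.exp_pos _).le) (fun σ _ => by
      rw [← Real.exp_add]
      simp [weightedEnergy])
  have hC := card_config_pos hm
  rw [averagedWeight, averagedWeight, div_mul_div_comm, le_div_iff₀ (by positivity)]
  simpa [sq] using h1

/-- With `y = F_N - β² / 2` this is `exp y ≤ 1 + exp(N y)`, true for `N ≥ 1` and either sign of `y`.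
-/
lemma exp_freeEnergy_le {a : Finset (Fin n) → ℝ} {m : Fin n → ℕ} (hm : ∀ i, 0 < m i) {N : ℕ}
    (hN : 0 < N) (β : ℝ) (x : Site a m → ℝ) :
    Real.exp (freeEnergy N β (hamiltonian a m x)) ≤ Real.exp (β ^ 2 / 2) *
      (1 + averagedWeight a m (fun _ => β) x / Real.exp (N * (β ^ 2 / 2))) := by
  have hN' : (1 : ℝ) ≤ N := by exact_mod_cast hN
  set F := freeEnergy N β (hamiltonian a m x) with hF
  have hZ := averagedWeight_pos hm (fun _ => β) x
  have h1 : averagedWeight a m (fun _ => β) x = Real.exp (N * F) := by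
    rw [hF, freeEnergy, partitionFunction_hamiltonian, ← mul_assoc, mul_one_div_cancel
      (by positivity), one_mul, Real.exp_log hZ]
  rw [h1, ← Real.exp_sub, ← mul_sub]
  have h2 : Real.exp (F - β ^ 2 / 2) ≤ 1 + Real.exp (N * (F - β ^ 2 / 2)) := by
    rcases le_total (F - β ^ 2 / 2) 0 with h | h
    · have := Real.exp_le_one_iff.2 h
      linarith [Real.exp_pos (N * (F - β ^ 2 / 2))]
    · have : Real.exp (F - β ^ 2 / 2) ≤ Real.exp (N * (F - β ^ 2 / 2)) :=
        Real.exp_le_exp.2 (le_mul_of_one_le_left h hN')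
      linarith
  calc Real.exp F = Real.exp (β ^ 2 / 2) * Real.exp (F - β ^ 2 / 2) := by
        rw [← Real.exp_add]; congr 1; ring
    _ ≤ _ := mul_le_mul_of_nonneg_left h2 (Real.exp_pos _).le

lemma exp_abs_freeEnergy_le {a : Finset (Fin n) → ℝ} {m : Fin n → ℕ} (hm : ∀ i, 0 < m i) {N : ℕ}
    (hN : 0 < N) (β : ℝ) (x : Site a m → ℝ) :
    Real.exp |freeEnergy N β (hamiltonian a m x)| ≤ dominant a m N β x := by
  have h1 := exp_freeEnergy_le hm hN β x
  have h2 := exp_freeEnergy_le hm hN (-β) x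
  have hneg : -freeEnergy N β (hamiltonian a m x) ≤ freeEnergy N (-β) (hamiltonian a m x) := by
    simp only [freeEnergy, partitionFunction_hamiltonian]
    have h3 := Real.log_nonneg (one_le_averagedWeight_mul hm β x)
    rw [Real.log_mul (averagedWeight_pos hm _ _).ne' (averagedWeight_pos hm _ _).ne'] at h3
    rw [← mul_neg]
    exact mul_le_mul_of_nonneg_left (by linarith) (by positivity)
  have h4 : ∀ c, 0 ≤ averagedWeight a m (fun _ => c) x / Real.exp (N * (β ^ 2 / 2)) := fun c =>
    div_nonneg (averagedWeight_pos hm _ _).le (Real.exp_pos _).le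
  have h5 := mul_nonneg (Real.exp_pos (β ^ 2 / 2)).le (h4 β)
  have h6 := mul_nonneg (Real.exp_pos (β ^ 2 / 2)).le (h4 (-β))
  have h7 := Real.exp_pos (β ^ 2 / 2)
  rw [neg_sq] at h2
  have h8 : dominant a m N β x = Real.exp (β ^ 2 / 2) *
      (1 + averagedWeight a m (fun _ => β) x / Real.exp (N * (β ^ 2 / 2))) +
      Real.exp (β ^ 2 / 2) *
      (1 + averagedWeight a m (fun _ => -β) x / Real.exp (N * (β ^ 2 / 2))) := by
    unfold dominant; ring
  rw [h8]
  rcases abs_choice (freeEnergy N β (hamiltonian a m x)) with h | h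
  · rw [h]
    linarith
  · rw [h]
    have := Real.exp_le_exp.2 hneg
    linarith

lemma integrable_freeEnergy (a : Finset (Fin n) → ℝ) {m : Fin n → ℕ}
    (hm : ∀ i, 0 < m i) (N : ℕ) (β : ℝ) :
    Integrable (fun x => freeEnergy N β (hamiltonian a m x)) (fieldLaw a m N) := by
  rcases N.eq_zero_or_pos with rfl | hN
  · simp [freeEnergy]
  · refine (integrable_dominant a m N β).mono' (measurable_freeEnergy a m N β).aestronglyMeasurable
      (ae_of_all _ fun x => ?_)
    rw [Real.norm_eq_abs]
    have := Real.add_one_le_exp |freeEnergy N β (hamiltonian a m x)|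
    linarith [exp_abs_freeEnergy_le hm hN β x]

lemma tendsto_integral_freeEnergy {a : Finset (Fin n) → ℝ} (ha : ∀ J, 0 ≤ a J)
    (ha_sum : ∑ J, a J = 1) {M : ℕ → Fin n → ℕ} (hM_pos : ∀ N i, 0 < M N i) {β v : ℝ}
    (h : ∀ ε > 0, ∃ c > 0, ∀ᶠ N : ℕ in atTop, (fieldLaw a (M N) N).real
      {x | ε < |freeEnergy N β (hamiltonian a (M N) x) - v|} ≤ Real.exp (-(c * N))) :
    Tendsto (fun N => ∫ x, freeEnergy N β (hamiltonian a (M N) x) ∂(fieldLaw a (M N) N)) atTop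
      (𝓝 v) := by
  rw [Metric.tendsto_nhds]
  intro ε hε
  set D := Real.exp |v| * (4 * Real.exp (β ^ 2 / 2)) with hD
  have hD0 : 0 < D := by positivity
  -- The level at which `|F - v|` is truncated, chosen to make the remainder `2 D / C` equal to `ε /
  -- 4`.
  set C := 8 * D / ε with hC
  have hC0 : 0 < C := by positivity
  obtain ⟨c, hc, h1⟩ := h (ε / 4) (by positivity)
  have h2 : Tendsto (fun N : ℕ => C * Real.exp (-(c * N))) atTop (𝓝 (C * 0)) :=
    (Real.tendsto_exp_neg_atTop_nhds_zero.comp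
      (Tendsto.const_mul_atTop hc tendsto_natCast_atTop_atTop)).const_mul C
  rw [mul_zero] at h2
  filter_upwards [h1, h2.eventually_lt_const (by positivity : 0 < ε / 4), eventually_gt_atTop 0]
    with N hN1 hN2 hN0
  set μ := fieldLaw a (M N) N
  set F : (Site a (M N) → ℝ) → ℝ := fun x => freeEnergy N β (hamiltonian a (M N) x) with hF
  set B : Set (Site a (M N) → ℝ) := {x | ε / 4 < |F x - v|} with hB
  have hBm : MeasurableSet B := measurableSet_lt measurable_const
    (((measurable_freeEnergy a (M N) N β).sub_const v).abs)
  have hiF : Integrable F μ := integrable_freeEnergy a (hM_pos N) N β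
  have hid : Integrable (fun x => Real.exp |v| * dominant a (M N) N β x) μ :=
    (integrable_dominant a (M N) N β).const_mul _
  have hpt : ∀ x, |F x - v| ≤ ε / 4 + B.indicator (fun _ => C) x +
      2 / C * (Real.exp |v| * dominant a (M N) N β x) := by
    intro x
    have h3 : Real.exp |F x - v| ≤ Real.exp |v| * dominant a (M N) N β x := by
      refine le_trans ?_ (mul_le_mul_of_nonneg_left (exp_abs_freeEnergy_le (hM_pos N) hN0 β x)
        (Real.exp_pos _).le)
      rw [← Real.exp_add, Real.exp_le_exp, add_comm]
      exact abs_sub _ _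
    have h4 := Real.quadratic_le_exp_of_nonneg (abs_nonneg (F x - v))
    set y := |F x - v| with hy
    have hy0 : 0 ≤ y := abs_nonneg _
    have h5 : 0 ≤ 2 / C * (Real.exp |v| * dominant a (M N) N β x) :=
      mul_nonneg (by positivity) ((Real.exp_pos _).le.trans h3)
    by_cases hx : x ∈ B
    · rw [Set.indicator_of_mem hx]
      rcases le_total y C with h6 | h6
      · linarith
      -- Above the truncation level `C y ≤ y² ≤ 2 exp y`.
      · have h7 : y ≤ 2 / C * (Real.exp |v| * dominant a (M N) N β x) := by
          rw [div_mul_eq_mul_div, le_div_iff₀ hC0]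
          nlinarith
        linarith
    · rw [Set.indicator_of_notMem hx]
      have : y ≤ ε / 4 := not_lt.1 hx
      linarith
  have hind : Integrable (B.indicator fun _ => C) μ := (integrable_const C).indicator hBm
  have h6 : Integrable (fun x => ε / 4 + B.indicator (fun _ => C) x) μ :=
    (integrable_const _).add hind
  have h7 : ∫ x, |F x - v| ∂μ ≤ ε / 4 + μ.real B * C + 2 / C * D := by
    refine (integral_mono (hiF.sub (integrable_const v)).abs
      (h6.add (hid.const_mul (2 / C))) hpt).trans (le_of_eq ?_)
    have h8 := integral_add h6 (hid.const_mul (2 / C))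
    refine h8.trans ?_
    rw [integral_add (integrable_const _) hind, integral_indicator_const _ hBm,
      integral_const_mul, integral_const_mul, integral_dominant ha ha_sum (hM_pos N)]
    simp [hD]
  have h8 : |(∫ x, F x ∂μ) - v| ≤ ∫ x, |F x - v| ∂μ := by
    have : (∫ x, F x ∂μ) - v = ∫ x, (F x - v) ∂μ := by
      rw [integral_sub hiF (integrable_const v)]; simp
    rw [this]
    exact abs_integral_le_integral_abs
  rw [Real.dist_eq]
  have h9 : 2 / C * D = ε / 4 := by rw [hC]; field_simp; norm_num
  have h10 : μ.real B * C ≤ Real.exp (-(c * N)) * C :=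
    mul_le_mul_of_nonneg_right hN1 hC0.le
  linarith

/-! ### The recursive chain -/

lemma alpha_eq {a : Finset (Fin n) → ℝ} (ha : ∀ J, 0 ≤ a J) (A : Finset (Fin n)) :
    alpha a A = ∑ J, if J ⊆ A then a J else 0 := by
  simpa [alpha] using sum_posSets_univ ha A fun _ => 1

lemma alpha_mono {a : Finset (Fin n) → ℝ} (ha : ∀ J, 0 ≤ a J) {A B : Finset (Fin n)}
    (h : A ⊆ B) : alpha a A ≤ alpha a B := by
  rw [alpha_eq ha, alpha_eq ha]
  refine Finset.sum_le_sum fun J _ => ?_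
  by_cases hJ : J ⊆ A
  · rw [if_pos hJ, if_pos (hJ.trans h)]
  · rw [if_neg hJ]
    split_ifs; exacts [ha J, le_rfl]

/-- A set `J` inside both `A` and `B` lies in `A ∩ B`; the sets inside `A ∪ B` but in neither count
only on the right. -/
lemma alpha_supermodular {a : Finset (Fin n) → ℝ} (ha : ∀ J, 0 ≤ a J) (A B : Finset (Fin n)) :
    alpha a A + alpha a B ≤ alpha a (A ∪ B) + alpha a (A ∩ B) := by
  simp only [alpha_eq ha, ← Finset.sum_add_distrib]
  refine Finset.sum_le_sum fun J _ => ?_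
  by_cases hA : J ⊆ A <;> by_cases hB : J ⊆ B
  · rw [if_pos hA, if_pos hB, if_pos (hA.trans Finset.subset_union_left),
      if_pos (Finset.subset_inter hA hB)]
  · rw [if_pos hA, if_neg hB, if_pos (hA.trans Finset.subset_union_left)]
    have := ha J
    split_ifs <;> linarith
  · rw [if_neg hA, if_pos hB, if_pos (hB.trans Finset.subset_union_right)]
    have := ha J
    split_ifs <;> linarith
  · rw [if_neg hA, if_neg hB]
    have := ha J
    split_ifs <;> linarith

lemma gam_modular (γ : Fin n → ℝ) (A B : Finset (Fin n)) :
    gam γ (A ∪ B) + gam γ (A ∩ B) = gam γ A + gam γ B :=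
  Finset.sum_union_inter

lemma gam_strictMono {γ : Fin n → ℝ} (hγ : ∀ i, 0 < γ i) {A B : Finset (Fin n)} (h : A ⊂ B) :
    gam γ A < gam γ B := by
  obtain ⟨i, hi, hi'⟩ := Finset.exists_of_ssubset h
  exact Finset.sum_lt_sum_of_subset h.1 hi hi' (hγ i) fun j _ _ => (hγ j).le

/-- This form is linear in `α` and `γ` and needs no separate case for `ρ = ∞`. -/
lemma le_rho_iff {a : Finset (Fin n) → ℝ} (ha : ∀ J, 0 ≤ a J) {γ : Fin n → ℝ}
    (hγ : ∀ i, 0 < γ i) {A B : Finset (Fin n)} (h : B ⊂ A) {r : ℝ} (hr : 0 ≤ r) :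
    ENNReal.ofReal r ≤ rho a γ B A ↔
      r ^ 2 * (alpha a A - alpha a B) ≤ 2 * Real.log 2 * (gam γ A - gam γ B) := by
  have hg : 0 < 2 * Real.log 2 * (gam γ A - gam γ B) :=
    mul_pos (mul_pos two_pos (Real.log_pos one_lt_two)) (sub_pos.2 (gam_strictMono hγ h))
  unfold rho
  split_ifs with h1
  · simp [h1, hg.le]
  · have h2 : 0 < alpha a A - alpha a B :=
      sub_pos.2 (lt_of_le_of_ne (alpha_mono ha h.1) (Ne.symm h1))
    rw [ENNReal.ofReal_le_ofReal_iff (Real.sqrt_nonneg _), Real.le_sqrt hr, le_div_iff₀ h2]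
    exact div_nonneg hg.le h2.le

lemma rho_eq_iff {a : Finset (Fin n) → ℝ} (ha : ∀ J, 0 ≤ a J) {γ : Fin n → ℝ}
    (hγ : ∀ i, 0 < γ i) {A B : Finset (Fin n)} (h : B ⊂ A) {r : ℝ} (hr : 0 ≤ r) :
    rho a γ B A = ENNReal.ofReal r ↔
      r ^ 2 * (alpha a A - alpha a B) = 2 * Real.log 2 * (gam γ A - gam γ B) := by
  have hg : 0 < 2 * Real.log 2 * (gam γ A - gam γ B) :=
    mul_pos (mul_pos two_pos (Real.log_pos one_lt_two)) (sub_pos.2 (gam_strictMono hγ h))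
  unfold rho
  split_ifs with h1
  · simp only [h1, sub_self, mul_zero]
    exact iff_of_false ENNReal.ofReal_ne_top.symm hg.ne
  · have h2 : 0 < alpha a A - alpha a B :=
      sub_pos.2 (lt_of_le_of_ne (alpha_mono ha h.1) (Ne.symm h1))
    rw [ENNReal.ofReal_eq_ofReal_iff (Real.sqrt_nonneg _) hr,
      Real.sqrt_eq_iff_eq_sq (div_nonneg hg.le h2.le) hr, div_eq_iff h2.ne', eq_comm]

lemma rhoHat_le {a : Finset (Fin n) → ℝ} {γ : Fin n → ℝ} {A B : Finset (Fin n)} (h : B ⊂ A) :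
    rhoHat a γ B ≤ rho a γ B A :=
  iInf₂_le A h

lemma exists_rho_eq_rhoHat (a : Finset (Fin n) → ℝ) (γ : Fin n → ℝ) {B : Finset (Fin n)}
    (hB : B ≠ Finset.univ) : ∃ A, B ⊂ A ∧ rho a γ B A = rhoHat a γ B := by
  classical
  obtain ⟨A, hA, hmin⟩ := Finset.exists_min_image (Finset.univ.filter fun A => B ⊂ A)
    (rho a γ B) ⟨Finset.univ, by simpa using Finset.ssubset_univ_iff.2 hB⟩
  have hA' := (Finset.mem_filter.1 hA).2
  exact ⟨A, hA', le_antisymm (le_iInf₂ fun C hC => hmin C (by simpa using hC)) (rhoHat_le hA')⟩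

lemma rhoHat_pos {a : Finset (Fin n) → ℝ} (ha : ∀ J, 0 ≤ a J) {γ : Fin n → ℝ}
    (hγ : ∀ i, 0 < γ i) {B : Finset (Fin n)} (hB : B ≠ Finset.univ) : 0 < rhoHat a γ B := by
  obtain ⟨A, hA, h⟩ := exists_rho_eq_rhoHat a γ hB
  rw [← h, pos_iff_ne_zero, ← ENNReal.ofReal_zero, Ne, rho_eq_iff ha hγ hA le_rfl]
  have := mul_pos (mul_pos two_pos (Real.log_pos one_lt_two)) (sub_pos.2 (gam_strictMono hγ hA))
  simpa using this.ne

/-- For finite `r = ρ̂(B)` the function `D ↦ 2 log 2 (γ(D) - γ(B)) - r² (α(D) - α(B))` is submodular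
and nonnegative on `D ⊇ B`, and the minimisers are its zeros other than `B`. Zeros of such a
function are closed under unions; `A ∩ C = B` is harmless because the function vanishes there. -/
lemma rho_union_eq {a : Finset (Fin n) → ℝ} (ha : ∀ J, 0 ≤ a J) {γ : Fin n → ℝ}
    (hγ : ∀ i, 0 < γ i) {B A C : Finset (Fin n)} (hA : B ⊂ A) (hC : B ⊂ C)
    (h1 : rho a γ B A = rhoHat a γ B) (h2 : rho a γ B C = rhoHat a γ B) :
    rho a γ B (A ∪ C) = rhoHat a γ B := by
  have hU : B ⊂ A ∪ C := hA.trans_subset Finset.subset_union_left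
  by_cases htop : rhoHat a γ B = ⊤
  · exact le_antisymm (htop ▸ le_top) (rhoHat_le hU)
  · have hr : rhoHat a γ B = ENNReal.ofReal (rhoHat a γ B).toReal :=
      (ENNReal.ofReal_toReal htop).symm
    have hle : ENNReal.ofReal (rhoHat a γ B).toReal ≤ rho a γ B (A ∪ C) := hr ▸ rhoHat_le hU
    set r := (rhoHat a γ B).toReal
    have hr0 : 0 ≤ r := ENNReal.toReal_nonneg
    rw [hr] at h1 h2 ⊢
    rw [rho_eq_iff ha hγ hA hr0] at h1
    rw [rho_eq_iff ha hγ hC hr0] at h2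
    rw [rho_eq_iff ha hγ hU hr0]
    rw [le_rho_iff ha hγ hU hr0] at hle
    have hI : r ^ 2 * (alpha a (A ∩ C) - alpha a B) ≤
        2 * Real.log 2 * (gam γ (A ∩ C) - gam γ B) := by
      rcases (Finset.subset_inter hA.1 hC.1).eq_or_ssubset with h | h
      · simp [← h]
      · exact (le_rho_iff ha hγ h hr0).1 (hr ▸ rhoHat_le h)
    have h3 := mul_le_mul_of_nonneg_left (alpha_supermodular ha A C) (sq_nonneg r)
    have h4 := congrArg (2 * Real.log 2 * ·) (gam_modular γ A C)
    linarith

/-- `A` is the largest set among the minimisers of `ρ(B, ·)`. -/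
def IsGreatestMinimiser (a : Finset (Fin n) → ℝ) (γ : Fin n → ℝ) (B A : Finset (Fin n)) :
    Prop :=
  B ⊂ A ∧ rho a γ B A = rhoHat a γ B ∧
    ∀ C : Finset (Fin n), B ⊂ C → rho a γ B C = rhoHat a γ B → C ⊆ A

lemma IsGreatestMinimiser.unique {a : Finset (Fin n) → ℝ} {γ : Fin n → ℝ}
    {B A A' : Finset (Fin n)} (h : IsGreatestMinimiser a γ B A)
    (h' : IsGreatestMinimiser a γ B A') : A = A' :=
  (h'.2.2 A h.1 h.2.1).antisymm (h.2.2 A' h'.1 h'.2.1)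

lemma exists_isGreatestMinimiser {a : Finset (Fin n) → ℝ} (ha : ∀ J, 0 ≤ a J) {γ : Fin n → ℝ}
    (hγ : ∀ i, 0 < γ i) {B : Finset (Fin n)} (hB : B ≠ Finset.univ) :
    ∃ A, IsGreatestMinimiser a γ B A := by
  classical
  obtain ⟨A₀, hA₀⟩ := exists_rho_eq_rhoHat a γ hB
  obtain ⟨A, hA, hmax⟩ := Finset.exists_max_image
    (Finset.univ.filter fun A => B ⊂ A ∧ rho a γ B A = rhoHat a γ B) Finset.card
    ⟨A₀, by simpa using hA₀⟩
  obtain ⟨hA1, hA2⟩ := (Finset.mem_filter.1 hA).2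
  refine ⟨A, hA1, hA2, fun C hC1 hC2 => ?_⟩
  have h := hmax (A ∪ C) (Finset.mem_filter.2 ⟨Finset.mem_univ _,
    hA1.trans_subset Finset.subset_union_left, rho_union_eq ha hγ hA1 hC1 hA2 hC2⟩)
  rw [Finset.eq_of_subset_of_card_le Finset.subset_union_left h]
  exact Finset.subset_union_right

/-- The defect `2 log 2 (γ(C) - γ(B)) - ρ̂(B)² (α(C) - α(B))` vanishes at `C = A` and is positive
for `C ⊋ A`, by maximality of `A`; subtracting gives a positive defect from `A` to `C`. If `ρ̂(B)`
were `∞`, the full set would be a minimiser and `A` would be full. -/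
lemma rhoHat_lt_of_isGreatestMinimiser {a : Finset (Fin n) → ℝ} (ha : ∀ J, 0 ≤ a J)
    {γ : Fin n → ℝ} (hγ : ∀ i, 0 < γ i) {B A : Finset (Fin n)}
    (h : IsGreatestMinimiser a γ B A) (hA : A ≠ Finset.univ) :
    rhoHat a γ B < rhoHat a γ A := by
  have hBu : B ⊂ Finset.univ := h.1.trans_subset (Finset.subset_univ A)
  have htop : rhoHat a γ B ≠ ⊤ := fun htop => hA (Finset.univ_subset_iff.1
    (h.2.2 _ hBu (le_antisymm (htop ▸ le_top) (rhoHat_le hBu))))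
  have hr : rhoHat a γ B = ENNReal.ofReal (rhoHat a γ B).toReal :=
    (ENNReal.ofReal_toReal htop).symm
  obtain ⟨C, hC, hCeq⟩ := exists_rho_eq_rhoHat a γ hA
  have hBC := h.1.trans hC
  have h1 := h.2.1
  have h2 : rho a γ B C ≠ rhoHat a γ B := fun h2 => hC.2 (h.2.2 C hBC h2)
  have h3 : rhoHat a γ B ≤ rho a γ B C := rhoHat_le hBC
  rw [← hCeq]
  set r := (rhoHat a γ B).toReal
  have hr0 : 0 ≤ r := ENNReal.toReal_nonneg
  rw [hr] at h1 h2 h3 ⊢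
  rw [rho_eq_iff ha hγ h.1 hr0] at h1
  rw [Ne, rho_eq_iff ha hγ hBC hr0] at h2
  rw [le_rho_iff ha hγ hBC hr0] at h3
  have h4 := lt_of_le_of_ne h3 h2
  refine lt_of_le_of_ne ((le_rho_iff ha hγ hC hr0).2 (by linarith)) fun h5 => ?_
  have := (rho_eq_iff ha hγ hC hr0).1 h5.symm
  linarith

/-! ### Existence and uniqueness of the recursive chain -/

lemma Chain.castSucc_ssubset (T : Chain n) (j : Fin T.K) : T.A j.castSucc ⊂ T.A j.succ :=
  T.strictMono Fin.castSucc_lt_succ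

lemma Chain.castSucc_ne_univ (T : Chain n) (j : Fin T.K) : T.A j.castSucc ≠ Finset.univ :=
  Finset.ssubset_univ_iff.1 ((T.castSucc_ssubset j).trans_subset (Finset.subset_univ _))

lemma Chain.IsRecursive.isGreatestMinimiser {T : Chain n} {a : Finset (Fin n) → ℝ}
    {γ : Fin n → ℝ} (h : T.IsRecursive a γ) (j : Fin T.K) :
    IsGreatestMinimiser a γ (T.A j.castSucc) (T.A j.succ) :=
  ⟨T.castSucc_ssubset j, (h j).1, (h j).2⟩

open Classical in
/-- The largest minimiser of `ρ(B, ·)`, or the full set if there is none. -/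
def nextSet (a : Finset (Fin n) → ℝ) (γ : Fin n → ℝ) (B : Finset (Fin n)) : Finset (Fin n) :=
  if h : ∃ A, IsGreatestMinimiser a γ B A then h.choose else Finset.univ

lemma isGreatestMinimiser_nextSet {a : Finset (Fin n) → ℝ} (ha : ∀ J, 0 ≤ a J) {γ : Fin n → ℝ}
    (hγ : ∀ i, 0 < γ i) {B : Finset (Fin n)} (hB : B ≠ Finset.univ) :
    IsGreatestMinimiser a γ B (nextSet a γ B) := by
  have h := exists_isGreatestMinimiser ha hγ hB
  rw [nextSet, dif_pos h]
  exact h.choose_spec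

lemma Chain.IsRecursive.apply_eq {T : Chain n} {a : Finset (Fin n) → ℝ} (ha : ∀ J, 0 ≤ a J)
    {γ : Fin n → ℝ} (hγ : ∀ i, 0 < γ i) (h : T.IsRecursive a γ) (j : Fin (T.K + 1)) :
    T.A j = (nextSet a γ)^[j] ∅ := by
  induction j using Fin.induction with
  | zero => exact T.first
  | succ j ih =>
    rw [Fin.val_succ, Function.iterate_succ_apply', ← Fin.val_castSucc j, ← ih]
    exact (h.isGreatestMinimiser j).unique
      (isGreatestMinimiser_nextSet ha hγ (T.castSucc_ne_univ j))

lemma Chain.IsRecursive.unique {T T' : Chain n} {a : Finset (Fin n) → ℝ} (ha : ∀ J, 0 ≤ a J)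
    {γ : Fin n → ℝ} (hγ : ∀ i, 0 < γ i) (h : T.IsRecursive a γ) (h' : T'.IsRecursive a γ) :
    T' = T := by
  -- Both chains follow the orbit of `∅` under `nextSet`; the shorter one would reach the full set
  -- at an index where the longer one is still a proper subset.
  have key : ∀ {S S' : Chain n}, S.IsRecursive a γ → S'.IsRecursive a γ → ¬ S.K < S'.K := by
    intro S S' hS hS' hlt
    have h1 := hS.apply_eq ha hγ (Fin.last S.K)
    have h2 := hS'.apply_eq ha hγ (Fin.castSucc ⟨S.K, hlt⟩)
    rw [S.last] at h1
    exact S'.castSucc_ne_univ ⟨S.K, hlt⟩ (h2.trans h1.symm)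
  have hK : T'.K = T.K := le_antisymm (not_lt.1 (key h h')) (not_lt.1 (key h' h))
  have hA := h.apply_eq ha hγ
  have hA' := h'.apply_eq ha hγ
  obtain ⟨K, A, _, _, _⟩ := T
  obtain ⟨K', A', _, _, _⟩ := T'
  dsimp only at hK hA hA'
  subst hK
  have : A' = A := funext fun j => (hA' j).trans (hA j).symm
  subst this
  rfl

/-- The orbit of `∅` under `nextSet` increases strictly until it first reaches the full set, which
finiteness forces; that index is `K`. -/
lemma exists_isRecursive {a : Finset (Fin n) → ℝ} (ha : ∀ J, 0 ≤ a J) {γ : Fin n → ℝ}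
    (hγ : ∀ i, 0 < γ i) : ∃ T : Chain n, T.IsRecursive a γ := by
  classical
  set B : ℕ → Finset (Fin n) := fun i => (nextSet a γ)^[i] ∅ with hB
  have hsucc : ∀ i, B (i + 1) = nextSet a γ (B i) := fun i =>
    Function.iterate_succ_apply' _ _ _
  have hmin : ∀ i, B i ≠ Finset.univ → IsGreatestMinimiser a γ (B i) (B (i + 1)) := fun i hi =>
    hsucc i ▸ isGreatestMinimiser_nextSet ha hγ hi
  have hex : ∃ i, B i = Finset.univ := by
    by_contra hcon
    push Not at hcon
    have hmono : StrictMono B := strictMono_nat_of_lt_succ fun i => (hmin i (hcon i)).1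
    exact not_injective_infinite_finite B hmono.injective
  refine ⟨⟨Nat.find hex, fun j => B j, ?_, rfl, Nat.find_spec hex⟩, fun j => ?_⟩
  · exact Fin.strictMono_iff_lt_succ.2 fun j => (hmin j (Nat.find_min hex j.2)).1
  · exact (hmin j (Nat.find_min hex j.2)).2

lemma Chain.crit_succ (T : Chain n) (a : Finset (Fin n) → ℝ) (γ : Fin n → ℝ) (j : Fin T.K) :
    T.crit a γ j.succ = rhoHat a γ (T.A j.castSucc) :=
  rfl

lemma Chain.IsRecursive.strictMono_crit {T : Chain n} {a : Finset (Fin n) → ℝ}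
    (ha : ∀ J, 0 ≤ a J) {γ : Fin n → ℝ} (hγ : ∀ i, 0 < γ i) (h : T.IsRecursive a γ) :
    StrictMono (T.crit a γ) := by
  refine Fin.strictMono_iff_lt_succ.2 fun j => ?_
  rw [T.crit_succ]
  rcases Fin.eq_zero_or_eq_succ j.castSucc with h0 | ⟨i, hi⟩
  · rw [h0]
    have : T.A 0 ≠ Finset.univ := h0 ▸ T.castSucc_ne_univ j
    exact rhoHat_pos ha hγ this
  · have := T.castSucc_ne_univ j
    rw [hi] at this ⊢
    rw [T.crit_succ]
    exact rhoHat_lt_of_isGreatestMinimiser ha hγ (h.isGreatestMinimiser i) this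

/-- A level containing a point outside `A_{K-1}` makes `α(I) > α(A_{K-1})`, so `ρ(A_{K-1}, I)` is
finite. -/
lemma Chain.crit_last_lt_top (T : Chain n) {a : Finset (Fin n) → ℝ}
    (ha : ∀ J, 0 ≤ a J) {γ : Fin n → ℝ}
    (hcover : ∀ i, ∃ J ∈ posSets a Finset.univ, i ∈ J) :
    T.crit a γ (Fin.last T.K) < ⊤ := by
  rcases Fin.eq_zero_or_eq_succ (Fin.last T.K) with h0 | ⟨i, hi⟩
  · rw [h0]; exact ENNReal.zero_lt_top
  · rw [hi, T.crit_succ]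
    have hne := T.castSucc_ne_univ i
    obtain ⟨x, hx⟩ : ∃ x, x ∉ T.A i.castSucc := by
      by_contra hcon
      push Not at hcon
      exact hne (Finset.eq_univ_iff_forall.2 hcon)
    obtain ⟨J, hJ, hxJ⟩ := hcover x
    have hlt : alpha a (T.A i.castSucc) < alpha a Finset.univ := by
      refine Finset.sum_lt_sum_of_subset (i := J) ?_ hJ (fun hJ' => ?_)
        (Finset.mem_filter.1 hJ).2 fun J _ _ => ha J
      · exact Finset.filter_subset_filter _ (Finset.powerset_mono.2 (Finset.subset_univ _))
      · exact hx (Finset.mem_powerset.1 (Finset.mem_filter.1 hJ').1 hxJ)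
    refine lt_of_le_of_lt (rhoHat_le (Finset.ssubset_univ_iff.2 hne)) ?_
    rw [rho, if_neg hlt.ne']
    exact ENNReal.ofReal_lt_top

/-! ### Sums over the layers of a chain -/

lemma mem_posSets {a : Finset (Fin n) → ℝ} {A J : Finset (Fin n)} :
    J ∈ posSets a A ↔ J ⊆ A ∧ 0 < a J := by
  simp [posSets]

lemma posSets_mono (a : Finset (Fin n) → ℝ) {A B : Finset (Fin n)} (h : A ⊆ B) :
    posSets a A ⊆ posSets a B := fun _ hJ =>
  mem_posSets.2 ⟨(mem_posSets.1 hJ).1.trans h, (mem_posSets.1 hJ).2⟩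

lemma posSets_empty {a : Finset (Fin n) → ℝ} (ha_empty : a ∅ = 0) : posSets a ∅ = ∅ :=
  Finset.eq_empty_of_forall_notMem fun _ hJ => empty_notMem_posSets ha_empty hJ
    (Finset.subset_empty.1 (mem_posSets.1 hJ).1)

lemma sum_posSets_eq_add (a w : Finset (Fin n) → ℝ) {A B : Finset (Fin n)} (h : A ⊆ B) :
    ∑ J ∈ posSets a B, w J = ∑ J ∈ posSets a A, w J + ∑ J ∈ posSets a B \ posSets a A, w J := by
  rw [add_comm, Finset.sum_sdiff (posSets_mono a h)]

lemma filter_castSucc_lt_succ {K : ℕ} (k : Fin K) :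
    (Finset.univ.filter fun i : Fin K => i.castSucc < k.succ) =
      insert k (Finset.univ.filter fun i : Fin K => i.castSucc < k.castSucc) := by
  ext i
  simp only [Finset.mem_filter, Finset.mem_univ, true_and, Finset.mem_insert, Fin.lt_def,
    Fin.ext_iff, Fin.val_castSucc, Fin.val_succ]
  omega

lemma sum_castSucc_lt_succ {K : ℕ} (k : Fin K) (g : Fin K → ℝ) :
    ∑ i : Fin K with i.castSucc < k.succ, g i =
      ∑ i : Fin K with i.castSucc < k.castSucc, g i + g k := by
  rw [filter_castSucc_lt_succ, Finset.sum_insert (by simp), add_comm]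

lemma Chain.sum_layers (S : Chain n) {a : Finset (Fin n) → ℝ} (ha_empty : a ∅ = 0)
    (w : Finset (Fin n) → ℝ) (k : Fin (S.K + 1)) :
    ∑ J ∈ posSets a (S.A k), w J = ∑ i : Fin S.K with i.castSucc < k,
      ∑ J ∈ posSets a (S.A i.succ) \ posSets a (S.A i.castSucc), w J := by
  induction k using Fin.induction with
  | zero => simp [S.first, posSets_empty ha_empty]
  | succ k ih =>
    rw [sum_castSucc_lt_succ, ← ih, ← sum_posSets_eq_add a w (S.castSucc_ssubset k).1]

lemma Chain.sum_layers_univ (S : Chain n) {a : Finset (Fin n) → ℝ} (ha_empty : a ∅ = 0)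
    (w : Finset (Fin n) → ℝ) :
    ∑ J ∈ posSets a Finset.univ, w J = ∑ i : Fin S.K,
      ∑ J ∈ posSets a (S.A i.succ) \ posSets a (S.A i.castSucc), w J := by
  have := S.sum_layers ha_empty w (Fin.last S.K)
  simpa [S.last, Fin.castSucc_lt_last] using this

lemma Chain.hatWeight_eq (S : Chain n) (a : Finset (Fin n) → ℝ) (j : Fin S.K) :
    S.hatWeight a j = alpha a (S.A j.succ) - alpha a (S.A j.castSucc) := by
  rw [eq_sub_iff_add_eq']
  exact (sum_posSets_eq_add a a (S.castSucc_ssubset j).1).symm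

lemma Chain.hatWeight_nonneg (S : Chain n) {a : Finset (Fin n) → ℝ} (ha : ∀ J, 0 ≤ a J)
    (j : Fin S.K) : 0 ≤ S.hatWeight a j :=
  Finset.sum_nonneg fun J _ => ha J

/-- The function with the value `e j` on the subsets of `A_{j+1}` not contained in `A_j`. -/
def Chain.profile (S : Chain n) (e : Fin S.K → ℝ) (J : Finset (Fin n)) : ℝ :=
  ∑ j, if J ⊆ S.A j.succ ∧ ¬ J ⊆ S.A j.castSucc then e j else 0

lemma Chain.subset_iff_le (S : Chain n) {J : Finset (Fin n)} {j : Fin S.K}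
    (h1 : J ⊆ S.A j.succ) (h2 : ¬ J ⊆ S.A j.castSucc) (k : Fin (S.K + 1)) :
    J ⊆ S.A k ↔ j.castSucc < k := by
  constructor
  · intro h
    by_contra hcon
    exact h2 (h.trans (S.strictMono.monotone (not_lt.1 hcon)))
  · intro h
    exact h1.trans (S.strictMono.monotone (Fin.castSucc_lt_iff_succ_le.1 h))

lemma Chain.profile_eq (S : Chain n) (e : Fin S.K → ℝ) {J : Finset (Fin n)} {j : Fin S.K}
    (h1 : J ⊆ S.A j.succ) (h2 : ¬ J ⊆ S.A j.castSucc) : S.profile e J = e j := by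
  rw [profile, Finset.sum_eq_single j, if_pos ⟨h1, h2⟩]
  · intro i _ hij
    refine if_neg ?_
    rw [S.subset_iff_le h1 h2, S.subset_iff_le h1 h2, Fin.castSucc_lt_succ_iff, not_lt,
      Fin.castSucc_le_castSucc_iff]
    exact fun h => hij (le_antisymm h.2 h.1)
  · simp

lemma Chain.profile_eq_of_mem (S : Chain n) (e : Fin S.K → ℝ) {a : Finset (Fin n) → ℝ}
    {J : Finset (Fin n)} {j : Fin S.K}
    (h : J ∈ posSets a (S.A j.succ) \ posSets a (S.A j.castSucc)) : S.profile e J = e j := by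
  obtain ⟨h1, h2⟩ := Finset.mem_sdiff.1 h
  exact S.profile_eq e (mem_posSets.1 h1).1 fun h3 =>
    h2 (mem_posSets.2 ⟨h3, (mem_posSets.1 h1).2⟩)

lemma Chain.profile_nonneg (S : Chain n) {e : Fin S.K → ℝ} (he : ∀ j, 0 ≤ e j)
    (J : Finset (Fin n)) : 0 ≤ S.profile e J :=
  Finset.sum_nonneg fun j _ => by split_ifs; exacts [he j, le_rfl]

lemma Chain.exists_level (S : Chain n) {J : Finset (Fin n)} (hJ : J ≠ ∅) :
    ∃ j : Fin S.K, J ⊆ S.A j.succ ∧ ¬ J ⊆ S.A j.castSucc := by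
  by_contra! hcon
  have : ∀ k, J ⊆ S.A k := fun k => by
    induction k using Fin.reverseInduction with
    | last => rw [S.last]; exact Finset.subset_univ J
    | cast k ih => exact hcon k ih
  have h0 := this 0
  rw [S.first] at h0
  exact hJ (Finset.subset_empty.1 h0)

lemma Chain.sum_profile (S : Chain n) {a : Finset (Fin n) → ℝ} (ha_empty : a ∅ = 0)
    (e : Fin S.K → ℝ) (φ : ℝ → ℝ) (k : Fin (S.K + 1)) :
    ∑ J ∈ posSets a (S.A k), a J * φ (S.profile e J) =
      ∑ i : Fin S.K with i.castSucc < k,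
        (alpha a (S.A i.succ) - alpha a (S.A i.castSucc)) * φ (e i) := by
  rw [S.sum_layers ha_empty]
  refine Finset.sum_congr rfl fun i _ => ?_
  rw [← S.hatWeight_eq, hatWeight, Finset.sum_mul]
  exact Finset.sum_congr rfl fun J hJ => by rw [S.profile_eq_of_mem e hJ]

lemma Chain.value_profile (S : Chain n) {a : Finset (Fin n) → ℝ} (ha_empty : a ∅ = 0)
    (e : Fin S.K → ℝ) (β : ℝ) :
    value a β (S.profile e) = ∑ i : Fin S.K,
      (alpha a (S.A i.succ) - alpha a (S.A i.castSucc)) * (β * e i - e i ^ 2 / 2) := by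
  have := S.sum_profile ha_empty e (fun y => β * y - y ^ 2 / 2) (Fin.last S.K)
  simpa [value, S.last, Fin.castSucc_lt_last] using this

/-! ### The optimal profile -/

/-- `min (β, β_{j+1})`, the slope of the optimal profile on the `j`-th layer. -/
def Chain.slope (T : Chain n) (a : Finset (Fin n) → ℝ) (γ : Fin n → ℝ) (β : ℝ)
    (j : Fin T.K) : ℝ :=
  (min (ENNReal.ofReal β) (T.crit a γ j.succ)).toReal

lemma Chain.slope_nonneg (T : Chain n) (a : Finset (Fin n) → ℝ) (γ : Fin n → ℝ) (β : ℝ)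
    (j : Fin T.K) : 0 ≤ T.slope a γ β j :=
  ENNReal.toReal_nonneg

lemma Chain.ofReal_slope (T : Chain n) (a : Finset (Fin n) → ℝ) (γ : Fin n → ℝ) (β : ℝ)
    (j : Fin T.K) :
    ENNReal.ofReal (T.slope a γ β j) = min (ENNReal.ofReal β) (T.crit a γ j.succ) :=
  ENNReal.ofReal_toReal (ne_top_of_le_ne_top ENNReal.ofReal_ne_top (min_le_left _ _))

lemma Chain.slope_le (T : Chain n) (a : Finset (Fin n) → ℝ) (γ : Fin n → ℝ) {β : ℝ}
    (hβ : 0 ≤ β) (j : Fin T.K) : T.slope a γ β j ≤ β :=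
  ENNReal.toReal_le_of_le_ofReal hβ (min_le_left _ _)

lemma Chain.slope_eq_of_le (T : Chain n) (a : Finset (Fin n) → ℝ) (γ : Fin n → ℝ) {β : ℝ}
    (hβ : 0 ≤ β) {j : Fin T.K} (h : ENNReal.ofReal β ≤ T.crit a γ j.succ) :
    T.slope a γ β j = β := by
  rw [slope, min_eq_left h, ENNReal.toReal_ofReal hβ]

lemma Chain.slope_eq_of_ge (T : Chain n) (a : Finset (Fin n) → ℝ) (γ : Fin n → ℝ) {β : ℝ}
    {j : Fin T.K} (h : T.crit a γ j.succ ≤ ENNReal.ofReal β) :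
    T.slope a γ β j = (T.crit a γ j.succ).toReal := by
  rw [slope, min_eq_right h]

lemma Chain.IsRecursive.slope_mono {T : Chain n} {a : Finset (Fin n) → ℝ} (ha : ∀ J, 0 ≤ a J)
    {γ : Fin n → ℝ} (hγ : ∀ i, 0 < γ i) (h : T.IsRecursive a γ) (β : ℝ) :
    Monotone (T.slope a γ β) := fun _ _ hij =>
  ENNReal.toReal_mono (ne_top_of_le_ne_top ENNReal.ofReal_ne_top (min_le_left _ _))
    (min_le_min le_rfl ((h.strictMono_crit ha hγ).monotone (Fin.succ_le_succ_iff.2 hij)))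

lemma Chain.IsRecursive.slope_pos {T : Chain n} {a : Finset (Fin n) → ℝ} (ha : ∀ J, 0 ≤ a J)
    {γ : Fin n → ℝ} (hγ : ∀ i, 0 < γ i) {β : ℝ} (hβ : 0 < β) (j : Fin T.K) :
    0 < T.slope a γ β j := by
  rw [← ENNReal.ofReal_pos, T.ofReal_slope, lt_min_iff, T.crit_succ]
  exact ⟨ENNReal.ofReal_pos.2 hβ, rhoHat_pos ha hγ (T.castSucc_ne_univ j)⟩

lemma Chain.slope_sq_mul_le (T : Chain n) {a : Finset (Fin n) → ℝ} (ha : ∀ J, 0 ≤ a J)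
    {γ : Fin n → ℝ} (hγ : ∀ i, 0 < γ i) (β : ℝ) (j : Fin T.K) {D : Finset (Fin n)}
    (hD : T.A j.castSucc ⊆ D) :
    T.slope a γ β j ^ 2 * (alpha a D - alpha a (T.A j.castSucc)) ≤
      2 * Real.log 2 * (gam γ D - gam γ (T.A j.castSucc)) := by
  rcases hD.eq_or_ssubset with h | h
  · simp [h]
  · rw [← le_rho_iff ha hγ h (T.slope_nonneg a γ β j), T.ofReal_slope]
    exact (min_le_right _ _).trans (rhoHat_le h)

lemma Chain.IsRecursive.crit_sq_mul_eq {T : Chain n} {a : Finset (Fin n) → ℝ}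
    (ha : ∀ J, 0 ≤ a J) {γ : Fin n → ℝ} (hγ : ∀ i, 0 < γ i) (h : T.IsRecursive a γ) {j : Fin T.K}
    (htop : T.crit a γ j.succ ≠ ⊤) :
    (T.crit a γ j.succ).toReal ^ 2 * (alpha a (T.A j.succ) - alpha a (T.A j.castSucc)) =
      2 * Real.log 2 * (gam γ (T.A j.succ) - gam γ (T.A j.castSucc)) := by
  rw [← rho_eq_iff ha hγ (T.castSucc_ssubset j) ENNReal.toReal_nonneg, ENNReal.ofReal_toReal htop,
    T.crit_succ]
  exact (h j).1

/-- Build up `A` along `A ∩ A_k`. By supermodularity the increment of `α` is at most that from `A_k`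
to `(A ∩ A_{k+1}) ∪ A_k`. There the minimality in `ρ̂(A_k)` bounds the cost by the increment of `γ`,
which by modularity is that of `A ∩ A_k`. -/
lemma Chain.isFeasible_profile (T : Chain n) {a : Finset (Fin n) → ℝ} (ha : ∀ J, 0 ≤ a J)
    (ha_empty : a ∅ = 0) {γ : Fin n → ℝ} (hγ : ∀ i, 0 < γ i) (β : ℝ) :
    IsFeasible a γ (T.profile (T.slope a γ β)) where
  nonneg := T.profile_nonneg (T.slope_nonneg a γ β)
  budget_le A := by
    have key : ∀ k, budget a (T.profile (T.slope a γ β)) (A ∩ T.A k) ≤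
        gam γ (A ∩ T.A k) * Real.log 2 := by
      intro k
      induction k using Fin.induction with
      | zero => simp [T.first, budget, posSets_empty ha_empty, gam]
      | succ k ih =>
        have hsub : A ∩ T.A k.castSucc ⊆ A ∩ T.A k.succ :=
          Finset.inter_subset_inter_left (T.castSucc_ssubset k).1
        have h1 : budget a (T.profile (T.slope a γ β)) (A ∩ T.A k.succ) =
            budget a (T.profile (T.slope a γ β)) (A ∩ T.A k.castSucc) +
            T.slope a γ β k ^ 2 / 2 *
              (alpha a (A ∩ T.A k.succ) - alpha a (A ∩ T.A k.castSucc)) := by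
          have h2 := sum_posSets_eq_add a a hsub
          rw [budget, sum_posSets_eq_add a _ hsub, ← budget, alpha, alpha, h2, add_sub_cancel_left,
            Finset.mul_sum]
          congr 1
          refine Finset.sum_congr rfl fun J hJ => ?_
          obtain ⟨h3, h4⟩ := Finset.mem_sdiff.1 hJ
          rw [mem_posSets] at h3 h4
          rw [T.profile_eq (T.slope a γ β) (h3.1.trans Finset.inter_subset_right) fun h5 =>
            h4 ⟨Finset.subset_inter (h3.1.trans Finset.inter_subset_left) h5, h3.2⟩]
          ring
        have h2 : (A ∩ T.A k.succ) ∩ T.A k.castSucc = A ∩ T.A k.castSucc := by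
          rw [Finset.inter_assoc, Finset.inter_eq_right.2 (T.castSucc_ssubset k).1]
        have h3 := T.slope_sq_mul_le ha hγ β k
          (D := (A ∩ T.A k.succ) ∪ T.A k.castSucc) Finset.subset_union_right
        have h4 := alpha_supermodular ha (A ∩ T.A k.succ) (T.A k.castSucc)
        have h5 := gam_modular γ (A ∩ T.A k.succ) (T.A k.castSucc)
        rw [h2] at h4 h5
        have h6 := mul_le_mul_of_nonneg_left h4 (sq_nonneg (T.slope a γ β k))
        have h7 : gam γ ((A ∩ T.A k.succ) ∪ T.A k.castSucc) - gam γ (T.A k.castSucc) =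
          gam γ (A ∩ T.A k.succ) - gam γ (A ∩ T.A k.castSucc) := by linarith
        rw [h7] at h3
        rw [h1]
        linarith
    simpa [T.last] using key (Fin.last T.K)

/-- For `β ≥ β_k` every layer below `A_k` has slope `β_{i+1}`, where `ρ(A_i, A_{i+1})` is attained,
and so uses up exactly its entropy. The weights `a'` need only the same `α` along the chain, so the
statement also covers the GREM of `T`. -/
lemma Chain.IsRecursive.budget_eq {T : Chain n} {a : Finset (Fin n) → ℝ} (ha : ∀ J, 0 ≤ a J)
    {γ : Fin n → ℝ} (hγ : ∀ i, 0 < γ i) (h : T.IsRecursive a γ) {β : ℝ}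
    {a' : Finset (Fin n) → ℝ} (ha'_empty : a' ∅ = 0)
    (hα : ∀ k, alpha a' (T.A k) = alpha a (T.A k)) {k : Fin (T.K + 1)}
    (hk : T.crit a γ k ≤ ENNReal.ofReal β) :
    budget a' (T.profile (T.slope a γ β)) (T.A k) = gam γ (T.A k) * Real.log 2 := by
  have h1 : ∀ i : Fin T.K, i.castSucc < k → T.slope a γ β i ^ 2 *
      (alpha a' (T.A i.succ) - alpha a' (T.A i.castSucc)) =
      2 * Real.log 2 * (gam γ (T.A i.succ) - gam γ (T.A i.castSucc)) := fun i hi => by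
    have h2 : T.crit a γ i.succ ≤ ENNReal.ofReal β :=
      ((h.strictMono_crit ha hγ).monotone (Fin.castSucc_lt_iff_succ_le.1 hi)).trans hk
    rw [hα, hα, T.slope_eq_of_ge a γ h2,
      h.crit_sq_mul_eq ha hγ (ne_top_of_le_ne_top ENNReal.ofReal_ne_top h2)]
  clear hk
  induction k using Fin.induction with
  | zero => simp [T.first, budget, posSets_empty ha'_empty, gam]
  | succ k ih =>
    have h2 := h1 k Fin.castSucc_lt_succ
    have h3 := ih fun i hi => h1 i (hi.trans Fin.castSucc_lt_succ)
    have h4 : budget a' (T.profile (T.slope a γ β)) (T.A k.succ) =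
        budget a' (T.profile (T.slope a γ β)) (T.A k.castSucc) +
        (alpha a' (T.A k.succ) - alpha a' (T.A k.castSucc)) * (T.slope a γ β k ^ 2 / 2) := by
      simp only [budget, mul_div_assoc]
      rw [T.sum_profile ha'_empty _ (fun y => y ^ 2 / 2),
        T.sum_profile ha'_empty _ (fun y => y ^ 2 / 2), sum_castSucc_lt_succ]
    rw [h4, h3]
    linarith

lemma sum_ite_le_sub {K : ℕ} (E : ℕ → ℝ) (k : Fin K) :
    ∑ j : Fin K, (if k ≤ j then E j - E (j + 1) else 0) = E k - E K := by
  have h1 : ∑ j : Fin K, (if k ≤ j then E j - E (j + 1) else 0) =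
      ∑ j ∈ Finset.range K, if (k : ℕ) ≤ j then E j - E (j + 1) else 0 := by
    rw [← Fin.sum_univ_eq_sum_range fun j => if (k : ℕ) ≤ j then E j - E (j + 1) else 0]
    rfl
  have h2 : (Finset.range K).filter (fun j => (k : ℕ) ≤ j) = Finset.Ico (k : ℕ) K := by
    ext j; simp; omega
  rw [h1, ← Finset.sum_filter, h2, ← neg_inj, ← Finset.sum_neg_distrib, neg_sub,
    ← Finset.sum_Ico_sub E k.2.le]
  exact Finset.sum_congr rfl fun j _ => by ring

/-- Put the multiplier `β / e_j - β / e_{j+1}` on `A_{j+1}`, where `e_j` is the slope of layer `j`.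
It is nonnegative because slopes increase, and the sum over `j ≥ k` telescopes to `β / e_k - 1`,
which is stationarity on layer `k`. -/
lemma Chain.IsRecursive.exists_isDual {T : Chain n} {a : Finset (Fin n) → ℝ}
    (ha : ∀ J, 0 ≤ a J) {γ : Fin n → ℝ} (hγ : ∀ i, 0 < γ i) (h : T.IsRecursive a γ) {β : ℝ}
    (hβ : 0 ≤ β) {a' : Finset (Fin n) → ℝ} (ha'_empty : a' ∅ = 0)
    (hα : ∀ k, alpha a' (T.A k) = alpha a (T.A k)) :
    ∃ lam, IsDual a' γ β (T.profile (T.slope a γ β)) lam := by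
  rcases hβ.eq_or_lt with rfl | hβ
  -- At `β = 0` all slopes vanish and the quotients are meaningless; zero multipliers do.
  · refine ⟨0, fun _ => le_rfl, fun J _ => ?_, fun A hA => absurd rfl hA⟩
    have : T.slope a γ 0 = 0 := by
      funext j
      simp [slope]
    simp [this, profile]
  -- The value `β` past the last layer makes the telescoping sum end in `β / β = 1`.
  set E : ℕ → ℝ := fun i => if hi : i < T.K then T.slope a γ β ⟨i, hi⟩ else β with hE
  have hElt : ∀ j : Fin T.K, E j = T.slope a γ β j := fun j => by simp [hE, j.2]
  have hEK : E T.K = β := by simp [hE]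
  have hEpos : ∀ i, 0 < E i := fun i => by
    simp only [hE]
    split_ifs
    exacts [slope_pos ha hγ hβ _, hβ]
  have hEle : ∀ i, E i ≤ β := fun i => by
    simp only [hE]
    split_ifs
    exacts [T.slope_le a γ hβ.le _, le_rfl]
  have hEmono : ∀ i, E i ≤ E (i + 1) := fun i => by
    by_cases hi : i + 1 < T.K
    · have hi' : i < T.K := by omega
      simp only [hE, hi, hi', dif_pos]
      exact h.slope_mono ha hγ β (Fin.mk_le_mk.2 (Nat.le_succ i))
    · have : E (i + 1) = β := by simp only [hE, hi, dif_neg, not_false_iff]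
      rw [this]
      exact hEle i
  set l : ℕ → ℝ := fun i => β / E i - β / E (i + 1) with hl
  have hl0 : ∀ i, 0 ≤ l i := fun i =>
    sub_nonneg.2 (div_le_div_of_nonneg_left hβ.le (hEpos i) (hEmono i))
  classical
  refine ⟨fun A => ∑ j : Fin T.K, if A = T.A j.succ then l j else 0, fun A => ?_, fun J hJ => ?_,
    fun A hA => ?_⟩
  · exact Finset.sum_nonneg fun j _ => by split_ifs; exacts [hl0 j, le_rfl]
  · obtain ⟨k, hk1, hk2⟩ := T.exists_level (empty_notMem_posSets ha'_empty hJ)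
    have h1 : ∑ A : Finset (Fin n), (if J ⊆ A then
        ∑ j : Fin T.K, (if A = T.A j.succ then l j else 0) else 0) =
        ∑ j : Fin T.K, if k ≤ j then l j else 0 := by
      have h2 : ∀ A : Finset (Fin n), (if J ⊆ A then
          ∑ j : Fin T.K, (if A = T.A j.succ then l j else 0) else 0) =
          ∑ j : Fin T.K, if A = T.A j.succ then (if k ≤ j then l j else 0) else 0 := by
        intro A
        by_cases hJA : J ⊆ A
        · rw [if_pos hJA]
          refine Finset.sum_congr rfl fun j _ => ?_
          by_cases hAj : A = T.A j.succ
          · have : k ≤ j := by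
              rw [hAj, T.subset_iff_le hk1 hk2] at hJA
              exact Fin.castSucc_lt_succ_iff.1 hJA
            rw [if_pos hAj, if_pos hAj, if_pos this]
          · rw [if_neg hAj, if_neg hAj]
        · rw [if_neg hJA]
          refine (Finset.sum_eq_zero fun j _ => ?_).symm
          by_cases hAj : A = T.A j.succ
          · have : ¬ k ≤ j := fun hkj => hJA (by
              rw [hAj, T.subset_iff_le hk1 hk2]
              exact Fin.castSucc_lt_succ_iff.2 hkj)
            rw [if_pos hAj, if_neg this]
          · rw [if_neg hAj]
      simp only [h2]
      rw [Finset.sum_comm]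
      exact Finset.sum_congr rfl fun j _ => by simp
    rw [h1, T.profile_eq _ hk1 hk2, hl, sum_ite_le_sub (fun i => β / E i), hEK, hElt,
      div_self hβ.ne']
    have := slope_pos ha hγ hβ k
    field_simp
    ring
  · obtain ⟨j, _, hj⟩ := Finset.exists_ne_zero_of_sum_ne_zero hA
    have hAj : A = T.A j.succ := by
      by_contra hcon
      exact hj (if_neg hcon)
    rw [if_pos hAj] at hj
    rw [hAj]
    refine h.budget_eq ha hγ ha'_empty hα ?_
    -- If `β < β_{j+1}`, the slopes of layers `j` and `j + 1` both equal `β`, so the multiplier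
    -- would vanish.
    by_contra hcon
    have h1 : E j = β := (hElt j).trans (T.slope_eq_of_le a γ hβ.le (not_le.1 hcon).le)
    have h2 : E (j + 1) = β := le_antisymm (hEle _) (h1 ▸ hEmono j)
    exact hj (by simp only [hl, h1, h2, sub_self])

/-! ### The coarse-grained models -/

lemma Chain.weight_nonneg (S : Chain n) {a : Finset (Fin n) → ℝ} (ha : ∀ J, 0 ≤ a J)
    (J : Finset (Fin n)) : 0 ≤ S.weight a J :=
  Finset.sum_nonneg fun j _ => by split_ifs; exacts [S.hatWeight_nonneg ha j, le_rfl]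

lemma Chain.weight_empty (S : Chain n) (a : Finset (Fin n) → ℝ) : S.weight a ∅ = 0 :=
  Finset.sum_eq_zero fun j _ => if_neg fun h =>
    Finset.not_ssubset_empty _ (h ▸ S.castSucc_ssubset j)

lemma Chain.sum_posSets_weight (S : Chain n) {a : Finset (Fin n) → ℝ} (ha : ∀ J, 0 ≤ a J)
    (A : Finset (Fin n)) (g : Finset (Fin n) → ℝ) :
    ∑ J ∈ posSets (S.weight a) A, S.weight a J * g J =
      ∑ j : Fin S.K, if S.A j.succ ⊆ A then S.hatWeight a j * g (S.A j.succ) else 0 := by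
  rw [sum_posSets_univ (S.weight_nonneg ha) A g]
  have h1 : ∀ J : Finset (Fin n), (if J ⊆ A then S.weight a J * g J else 0) =
      ∑ j : Fin S.K, if J = S.A j.succ then
        (if S.A j.succ ⊆ A then S.hatWeight a j * g (S.A j.succ) else 0) else 0 := by
    intro J
    rw [weight, Finset.sum_mul]
    split_ifs with hJ
    · refine Finset.sum_congr rfl fun j _ => ?_
      split_ifs with h2 h3
      · rw [h2]
      · exact absurd (h2 ▸ hJ) ‹_›
      · exact zero_mul _
    · refine (Finset.sum_eq_zero fun j _ => ?_).symm
      split_ifs with h2 h3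
      · exact absurd (h2 ▸ h3) hJ
      · rfl
      · rfl
  simp only [h1]
  rw [Finset.sum_comm]
  exact Finset.sum_congr rfl fun j _ => by simp

lemma Chain.succ_subset_iff (S : Chain n) (j : Fin S.K) (k : Fin (S.K + 1)) :
    S.A j.succ ⊆ S.A k ↔ j.castSucc < k := by
  rw [Fin.castSucc_lt_iff_succ_le]
  exact S.strictMono.le_iff_le

lemma Chain.alpha_weight (S : Chain n) {a : Finset (Fin n) → ℝ} (ha : ∀ J, 0 ≤ a J)
    (ha_empty : a ∅ = 0) (k : Fin (S.K + 1)) :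
    alpha (S.weight a) (S.A k) = alpha a (S.A k) := by
  have h1 := S.sum_posSets_weight ha (S.A k) fun _ => 1
  simp only [mul_one, S.succ_subset_iff, ← Finset.sum_filter] at h1
  rw [alpha, h1, alpha, S.sum_layers ha_empty]
  rfl

lemma Chain.sum_weight (S : Chain n) {a : Finset (Fin n) → ℝ} (ha : ∀ J, 0 ≤ a J)
    (ha_empty : a ∅ = 0) : ∑ J, S.weight a J = ∑ J, a J := by
  have := S.alpha_weight ha ha_empty (Fin.last S.K)
  rw [S.last, alpha_eq ha, alpha_eq (S.weight_nonneg ha)] at this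
  simpa using this

/-- The mean of `b` over the layer between `A_j` and `A_{j+1}`. -/
def Chain.layerMean (S : Chain n) (a b : Finset (Fin n) → ℝ) (j : Fin S.K) : ℝ :=
  (∑ B ∈ posSets a (S.A j.succ) \ posSets a (S.A j.castSucc), a B * b B) / S.hatWeight a j

lemma Chain.profile_succ (S : Chain n) (e : Fin S.K → ℝ) (j : Fin S.K) :
    S.profile e (S.A j.succ) = e j :=
  S.profile_eq e subset_rfl (S.castSucc_ssubset j).2

/-- On a layer of weight zero every `a B` vanishes, so the value of the quotient does not matter. -/
lemma Chain.hatWeight_mul_layerMean (S : Chain n) {a : Finset (Fin n) → ℝ} (ha : ∀ J, 0 ≤ a J)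
    (b : Finset (Fin n) → ℝ) (j : Fin S.K) :
    S.hatWeight a j * S.layerMean a b j =
      ∑ B ∈ posSets a (S.A j.succ) \ posSets a (S.A j.castSucc), a B * b B := by
  by_cases h : S.hatWeight a j = 0
  · have h1 := (Finset.sum_eq_zero_iff_of_nonneg fun B _ => ha B).1 h
    rw [h, zero_mul, Finset.sum_eq_zero fun B hB => by rw [h1 B hB, zero_mul]]
  · rw [layerMean, mul_div_cancel₀ _ h]

lemma Chain.hatWeight_mul_layerMean_sq_le (S : Chain n) {a : Finset (Fin n) → ℝ}
    (ha : ∀ J, 0 ≤ a J) (b : Finset (Fin n) → ℝ) (j : Fin S.K) :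
    S.hatWeight a j * S.layerMean a b j ^ 2 ≤
      ∑ B ∈ posSets a (S.A j.succ) \ posSets a (S.A j.castSucc), a B * b B ^ 2 := by
  have h1 := Finset.sum_sq_le_sum_mul_sum_of_sq_le_mul
    (posSets a (S.A j.succ) \ posSets a (S.A j.castSucc)) (r := fun B => a B * b B) (f := a)
    (g := fun B => a B * b B ^ 2) (fun B _ => ha B)
    (fun B _ => mul_nonneg (ha B) (sq_nonneg _)) fun B _ => le_of_eq (by ring)
  rw [← S.hatWeight_mul_layerMean ha, ← hatWeight] at h1
  rcases (S.hatWeight_nonneg ha j).eq_or_lt with h | h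
  · rw [← h, zero_mul]
    exact Finset.sum_nonneg fun B _ => mul_nonneg (ha B) (sq_nonneg _)
  · refine le_of_mul_le_mul_left (le_trans (le_of_eq ?_) h1) h
    ring

/-- The GREM of `S` charges a layer to `A` only if `A_{j+1} ⊆ A`, when all its levels lie in `A`
anyway; averaging lowers the quadratic cost by Cauchy–Schwarz. -/
lemma Chain.isFeasible_layerMean (S : Chain n) {a : Finset (Fin n) → ℝ} (ha : ∀ J, 0 ≤ a J)
    (ha_empty : a ∅ = 0) {γ : Fin n → ℝ} {b : Finset (Fin n) → ℝ} (hb : IsFeasible a γ b) :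
    IsFeasible (S.weight a) γ (S.profile (S.layerMean a b)) where
  nonneg := S.profile_nonneg fun j => div_nonneg
    (Finset.sum_nonneg fun B _ => mul_nonneg (ha B) (hb.nonneg B)) (S.hatWeight_nonneg ha j)
  budget_le A := by
    refine le_trans ?_ (hb.budget_le A)
    rw [budget, budget, sum_posSets a A, S.sum_layers_univ ha_empty]
    simp only [mul_div_assoc]
    rw [S.sum_posSets_weight ha]
    refine Finset.sum_le_sum fun j _ => ?_
    have h0 : ∀ B, 0 ≤ a B * (b B ^ 2 / 2) := fun B => mul_nonneg (ha B) (by positivity)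
    split_ifs with hA
    · have h1 := S.hatWeight_mul_layerMean_sq_le ha b j
      have h2 : ∑ B ∈ posSets a (S.A j.succ) \ posSets a (S.A j.castSucc),
          (if B ⊆ A then a B * (b B ^ 2 / 2) else 0) =
          (∑ B ∈ posSets a (S.A j.succ) \ posSets a (S.A j.castSucc), a B * b B ^ 2) / 2 := by
        rw [Finset.sum_div]
        refine Finset.sum_congr rfl fun B hB => ?_
        rw [if_pos ((mem_posSets.1 (Finset.mem_sdiff.1 hB).1).1.trans hA)]
        ring
      rw [h2, S.profile_succ]
      linarith
    · exact Finset.sum_nonneg fun B _ => by split_ifs; exacts [h0 B, le_rfl]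

lemma Chain.value_le_value_layerMean (S : Chain n) {a : Finset (Fin n) → ℝ} (ha : ∀ J, 0 ≤ a J)
    (ha_empty : a ∅ = 0) (b : Finset (Fin n) → ℝ) (β : ℝ) :
    value a β b ≤ value (S.weight a) β (S.profile (S.layerMean a b)) := by
  rw [value, value, S.sum_layers_univ ha_empty, S.sum_posSets_weight ha]
  refine Finset.sum_le_sum fun j _ => ?_
  rw [if_pos (Finset.subset_univ _), S.profile_succ]
  have h1 := S.hatWeight_mul_layerMean_sq_le ha b j
  have h2 := S.hatWeight_mul_layerMean ha b j
  have h3 : ∑ B ∈ posSets a (S.A j.succ) \ posSets a (S.A j.castSucc),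
      a B * (β * b B - b B ^ 2 / 2) =
      β * ∑ B ∈ posSets a (S.A j.succ) \ posSets a (S.A j.castSucc), a B * b B -
      (∑ B ∈ posSets a (S.A j.succ) \ posSets a (S.A j.castSucc), a B * b B ^ 2) / 2 := by
    rw [Finset.mul_sum, Finset.sum_div, ← Finset.sum_sub_distrib]
    exact Finset.sum_congr rfl fun B _ => by ring
  rw [h3, ← h2]
  linarith

/-! ### The limiting free energy -/

/-- Below `A_k` the layers are frozen and their total cost is the entropy `γ(A_k) log 2`; above it
the slope is `β` and each level gives `a_J β² / 2`. For `k = K` the hypothesis `hk'` is empty, which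
encodes `β_{K+1} = ∞`. -/
lemma Chain.IsRecursive.value_profile_eq {T : Chain n} {a : Finset (Fin n) → ℝ}
    (ha : ∀ J, 0 ≤ a J) (ha_empty : a ∅ = 0) (ha_sum : ∑ J, a J = 1) {γ : Fin n → ℝ}
    (hγ : ∀ i, 0 < γ i) (h : T.IsRecursive a γ) {β : ℝ} (hβ : 0 ≤ β) (k : Fin (T.K + 1))
    (hk : T.crit a γ k ≤ ENNReal.ofReal β)
    (hk' : ∀ j : Fin T.K, j.castSucc = k → ENNReal.ofReal β ≤ T.crit a γ j.succ) :
    value a β (T.profile (T.slope a γ β)) =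
      β * (∑ i : Fin T.K with i.castSucc < k,
          (T.crit a γ i.succ).toReal * (alpha a (T.A i.succ) - alpha a (T.A i.castSucc)))
        - gam γ (T.A k) * Real.log 2 + β ^ 2 / 2 * (1 - alpha a (T.A k)) := by
  have hmono := (h.strictMono_crit ha hγ).monotone
  have huniv : alpha a Finset.univ = 1 := by rw [alpha_eq ha]; simpa using ha_sum
  have h1 : ∑ J ∈ posSets a (T.A k), a J * T.profile (T.slope a γ β) J =
      ∑ i : Fin T.K with i.castSucc < k,
        (T.crit a γ i.succ).toReal * (alpha a (T.A i.succ) - alpha a (T.A i.castSucc)) := by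
    rw [T.sum_profile ha_empty _ fun y => y]
    refine Finset.sum_congr rfl fun i hi => ?_
    rw [T.slope_eq_of_ge a γ ((hmono (Fin.castSucc_lt_iff_succ_le.1
      (Finset.mem_filter.1 hi).2)).trans hk), mul_comm]
  have h2 := h.budget_eq ha hγ ha_empty (fun _ => rfl) hk
  have h3 : ∀ J ∈ posSets a Finset.univ \ posSets a (T.A k),
      a J * (β * T.profile (T.slope a γ β) J - T.profile (T.slope a γ β) J ^ 2 / 2) =
        a J * (β ^ 2 / 2) := by
    intro J hJ
    obtain ⟨hJ1, hJ2⟩ := Finset.mem_sdiff.1 hJ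
    obtain ⟨j, hj1, hj2⟩ := T.exists_level (empty_notMem_posSets ha_empty hJ1)
    have hkj : k ≤ j.castSucc := by
      rw [← not_lt, ← T.subset_iff_le hj1 hj2]
      exact fun h4 => hJ2 (mem_posSets.2 ⟨h4, (mem_posSets.1 hJ1).2⟩)
    have hcrit : ENNReal.ofReal β ≤ T.crit a γ j.succ := by
      rcases hkj.eq_or_lt with h4 | h4
      · exact hk' j h4.symm
      · have hkK : k.val < T.K := lt_trans (Fin.lt_def.1 h4) j.2
        exact (hk' ⟨k, hkK⟩ rfl).trans (hmono (Fin.le_def.2 (Nat.succ_le_succ (Fin.le_def.1 hkj))))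
    rw [T.profile_eq _ hj1 hj2, T.slope_eq_of_le a γ hβ hcrit]
    ring
  have h4 : ∑ J ∈ posSets a (T.A k),
      a J * (β * T.profile (T.slope a γ β) J - T.profile (T.slope a γ β) J ^ 2 / 2) =
      β * ∑ J ∈ posSets a (T.A k), a J * T.profile (T.slope a γ β) J -
        budget a (T.profile (T.slope a γ β)) (T.A k) := by
    rw [budget, Finset.mul_sum, ← Finset.sum_sub_distrib]
    exact Finset.sum_congr rfl fun J _ => by ring
  have h5 := sum_posSets_eq_add a a (Finset.subset_univ (T.A k))
  rw [← alpha, ← alpha, huniv] at h5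
  rw [value, sum_posSets_eq_add a _ (Finset.subset_univ (T.A k)), h4, h1, h2,
    Finset.sum_congr rfl h3, ← Finset.sum_mul, h5]
  ring

/-- The limiting free energy of the model whose recursive chain is `T`. -/
def Chain.limitFreeEnergy (T : Chain n) (a : Finset (Fin n) → ℝ) (γ : Fin n → ℝ) (β : ℝ) : ℝ :=
  value a |β| (T.profile (T.slope a γ |β|))

lemma Chain.IsRecursive.freeEnergy_tail {T : Chain n} {a : Finset (Fin n) → ℝ}
    (ha : ∀ J, 0 ≤ a J) (ha_empty : a ∅ = 0) {γ : Fin n → ℝ} (hγ : ∀ i, 0 < γ i)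
    (h : T.IsRecursive a γ) {M : ℕ → Fin n → ℕ} (hM_pos : ∀ N i, 0 < M N i)
    (hM : ∀ i, Tendsto (fun N : ℕ => Real.logb 2 (M N i) / (N : ℝ)) atTop (𝓝 (γ i)))
    (β : ℝ) {ε : ℝ} (hε : 0 < ε) :
    ∃ c > 0, ∀ᶠ N : ℕ in atTop, (fieldLaw a (M N) N).real
      {x | ε < |freeEnergy N β (hamiltonian a (M N) x) - T.limitFreeEnergy a γ β|} ≤
        Real.exp (-(c * N)) := by
  obtain ⟨lam, hlam⟩ := h.exists_isDual ha hγ (abs_nonneg β) ha_empty fun _ => rfl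
  exact NHGrem.freeEnergy_tail ha ha_empty hγ hM_pos hM
    (T.isFeasible_profile ha ha_empty hγ |β|) hlam hε

/-- The layer means of the profile of `T` compete in the problem for the GREM of `S`, whose optimum
is certified by the recursive chain `T'` of that GREM. -/
lemma Chain.IsRecursive.limitFreeEnergy_le {T T' S : Chain n} {a : Finset (Fin n) → ℝ}
    (ha : ∀ J, 0 ≤ a J) (ha_empty : a ∅ = 0) {γ : Fin n → ℝ} (hγ : ∀ i, 0 < γ i)
    (h' : T'.IsRecursive (S.weight a) γ) (β : ℝ) :
    T.limitFreeEnergy a γ β ≤ T'.limitFreeEnergy (S.weight a) γ β := by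
  obtain ⟨lam, hlam⟩ := h'.exists_isDual (S.weight_nonneg ha) hγ (abs_nonneg β)
    (S.weight_empty a) fun _ => rfl
  exact (S.value_le_value_layerMean ha ha_empty _ _).trans
    ((S.isFeasible_layerMean ha ha_empty (T.isFeasible_profile ha ha_empty hγ |β|)).value_le
      (S.weight_nonneg ha) hlam)

/-- The profile of `T` stays certified as optimal for the weights of its own GREM, and its value
depends only on the unchanged numbers `α(A_k)`. -/
lemma Chain.IsRecursive.limitFreeEnergy_weight {T T' : Chain n} {a : Finset (Fin n) → ℝ}
    (ha : ∀ J, 0 ≤ a J) (ha_empty : a ∅ = 0) {γ : Fin n → ℝ} (hγ : ∀ i, 0 < γ i)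
    (h : T.IsRecursive a γ) (h' : T'.IsRecursive (T.weight a) γ) (β : ℝ) :
    T'.limitFreeEnergy (T.weight a) γ β = T.limitFreeEnergy a γ β := by
  refine le_antisymm ?_ (h'.limitFreeEnergy_le ha ha_empty hγ β)
  obtain ⟨lam, hlam⟩ := h.exists_isDual ha hγ (abs_nonneg β) (T.weight_empty a)
    (T.alpha_weight ha ha_empty)
  refine ((T'.isFeasible_profile (T.weight_nonneg ha) (T.weight_empty a) hγ |β|).value_le
    (T.weight_nonneg ha) hlam).trans (le_of_eq ?_)
  rw [limitFreeEnergy, T.value_profile (T.weight_empty a), T.value_profile ha_empty]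
  simp only [T.alpha_weight ha ha_empty]

end NHGrem

end

open NHGrem in
theorem theorem1 {n : ℕ}
    (a : Finset (Fin n) → ℝ) (ha : ∀ J, 0 ≤ a J) (ha_empty : a ∅ = 0) (ha_sum : ∑ J, a J = 1)
    (γ : Fin n → ℝ) (hγ : ∀ i, 0 < γ i) (hγ_sum : ∑ i, γ i = 1)
    -- `M N i` is the number of values of the spin `σ_i`; it is `2 ^ (γ_i N)` up to rounding
    (M : ℕ → Fin n → ℕ) (hM_pos : ∀ N i, 0 < M N i)
    (hM : ∀ i, Tendsto (fun N : ℕ => Real.logb 2 (M N i) / (N : ℝ)) atTop (𝓝 (γ i)))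
    {Ω : Type*} [MeasurableSpace Ω] (P : Measure Ω) [IsProbabilityMeasure P]
    (X : ∀ N : ℕ, Site a (M N) → Ω → ℝ)
    (hX : ∀ N : ℕ, IsGaussianField P a (M N) N (X N)) :
    ∃ (f : ℝ → ℝ) (fG : Chain n → ℝ → ℝ) (T : Chain n),
      -- the expectations that define `f_N(β)` and `f_N(S, β)` exist
      (∀ β N, Integrable
        (fun ω => freeEnergy N β (hamiltonian a (M N) fun s => X N s ω)) P) ∧
      (∀ (S : Chain n) β N, Integrable
        (fun x => freeEnergy N β (hamiltonian (S.weight a) (M N) x))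
        (fieldLaw (S.weight a) (M N) N)) ∧
      -- `f(β) = lim f_N(β)`, and `F_N(β) → f(β)` almost surely
      (∀ β, Tendsto
        (fun N => ∫ ω, freeEnergy N β (hamiltonian a (M N) fun s => X N s ω) ∂P)
        atTop (𝓝 (f β))) ∧
      (∀ β, ∀ᵐ ω ∂P, Tendsto
        (fun N => freeEnergy N β (hamiltonian a (M N) fun s => X N s ω))
        atTop (𝓝 (f β))) ∧
      -- `f(S, β) = lim f_N(S, β)` for every chain `S`
      (∀ (S : Chain n) β, Tendsto (fun N => S.freeEnergyN a (M N) N β) atTop (𝓝 (fG S β))) ∧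
      -- `T` is the unique chain that the recursion yields, and `0 = β_0 < β_1 < ⋯ < β_K`
      T.IsRecursive a γ ∧
      (∀ T' : Chain n, T'.IsRecursive a γ → T' = T) ∧
      StrictMono (T.crit a γ) ∧
      ((∀ i, ∃ J ∈ posSets a Finset.univ, i ∈ J) → T.crit a γ (Fin.last T.K) < ⊤) ∧
      -- `f(β) = f(T, β)` for all `β ≥ 0`, and `f(β) = min_S f(S, β)`
      (∀ β, 0 ≤ β → f β = fG T β) ∧
      (∀ β, IsLeast (Set.range fun S : Chain n => fG S β) (f β)) ∧
      -- the explicit formula for `β_k ≤ β ≤ β_{k+1}`, `0 ≤ k ≤ K`, with `β_{K+1} = ∞`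
      (∀ β, 0 ≤ β → ∀ k : Fin (T.K + 1),
        T.crit a γ k ≤ ENNReal.ofReal β →
        (∀ j : Fin T.K, j.castSucc = k → ENNReal.ofReal β ≤ T.crit a γ j.succ) →
        f β =
          β * (∑ i : Fin T.K with i.castSucc < k,
              (T.crit a γ i.succ).toReal * (alpha a (T.A i.succ) - alpha a (T.A i.castSucc)))
            - gam γ (T.A k) * Real.log 2
            + β ^ 2 / 2 * (1 - alpha a (T.A k))) := by
  obtain ⟨T, hT⟩ := exists_isRecursive ha hγ
  -- Each GREM is an instance of the same model, so its limit comes from its own recursive chain,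
  -- which need not be `S`.
  choose TS hTS using fun S : Chain n => exists_isRecursive (S.weight_nonneg ha) hγ
  -- Only the law for each fixed `N` enters, so everything is transferred to the product measures
  -- `fieldLaw`.
  have hlaw : ∀ N, HasLaw (fun ω s => X N s ω) (fieldLaw a (M N) N) P := fun N =>
    (hX N).hasLaw_field
  have hint : ∀ β N, ∫ ω, freeEnergy N β (hamiltonian a (M N) fun s => X N s ω) ∂P =
      ∫ x, freeEnergy N β (hamiltonian a (M N) x) ∂(fieldLaw a (M N) N) := fun β N => by
    rw [← (hlaw N).map_eq]
    exact (integral_map (hlaw N).aemeasurable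
      (measurable_freeEnergy a (M N) N β).aestronglyMeasurable).symm
  have htail := fun β (ε : ℝ) (hε : ε > 0) =>
    hT.freeEnergy_tail ha ha_empty hγ hM_pos hM β hε
  refine ⟨T.limitFreeEnergy a γ, fun S => (TS S).limitFreeEnergy (S.weight a) γ, T,
    fun β N => ?_, fun S β N => integrable_freeEnergy (S.weight a) (hM_pos N) N β, fun β => ?_,
    fun β => ?_, fun S β => ?_, hT, fun T' hT' => hT.unique ha hγ hT', hT.strictMono_crit ha hγ,
    T.crit_last_lt_top ha,
    fun β _ => (hT.limitFreeEnergy_weight ha ha_empty hγ (hTS T) β).symm, fun β => ⟨⟨T, ?_⟩, ?_⟩,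
    fun β hβ k hk hk' => ?_⟩
  · have h := integrable_freeEnergy a (hM_pos N) N β
    rw [← (hlaw N).map_eq] at h
    exact h.comp_aemeasurable (hlaw N).aemeasurable
  · simp only [hint]
    exact tendsto_integral_freeEnergy ha ha_sum hM_pos (htail β)
  · refine ae_tendsto_of_exp_tail fun ε hε => ?_
    obtain ⟨c, hc, h⟩ := htail β ε hε
    refine ⟨c, hc, h.mono fun N hN => le_trans (le_of_eq ?_) hN⟩
    exact (hlaw N).measureReal_eq (p := fun x =>
      ε < |freeEnergy N β (hamiltonian a (M N) x) - T.limitFreeEnergy a γ β|)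
      (measurableSet_lt measurable_const
        (((measurable_freeEnergy a (M N) N β).sub_const _).abs))
  · exact tendsto_integral_freeEnergy (S.weight_nonneg ha)
      ((S.sum_weight ha ha_empty).trans ha_sum) hM_pos fun ε hε =>
        (hTS S).freeEnergy_tail (S.weight_nonneg ha) (S.weight_empty a) hγ hM_pos hM β hε
  · exact hT.limitFreeEnergy_weight ha ha_empty hγ (hTS T) β
  · rintro _ ⟨S, rfl⟩
    exact (hTS S).limitFreeEnergy_le ha ha_empty hγ β
  · rw [Chain.limitFreeEnergy, abs_of_nonneg hβ]
    exact hT.value_profile_eq ha ha_empty ha_sum hγ hβ k hk hk'
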